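/- Let $A$ be an artin algebra, that is, an algebra over a commutative artinian ring $R$ which is finitely generated as an $R$-module. Modules are left $A$-modules, not necessarily finitely generated, and $\mathrm{Hom}=\mathrm{Hom}_A$. A module is Gorenstein-projective if it is isomorphic to the zeroth cocycle $Z^0(P^\bullet)$ of an acyclic complex $P^\bullet$ (indexed by $\mathbb{Z}$) of projective modules such that $\mathrm{Hom}(P^\bullet,Q)$ is acyclic for every projective module $Q$. Dually, a module is Gorenstein-injective if it is isomorphic to the zeroth coboundary $B^0(I^\bullet)$ of an acyclic complex $I^\bullet$ of injective modules such that $\mathrm{Hom}(J,I^\bullet)$ is acyclic for every injective module $J$. A proper Gorenstein-projective resolution of a module $M$ is an acyclic complex $\cdots\to G^{-1}\to G^{0}\to M\to 0$ with all $G^{-i}$ Gorenstein-projective which stays acyclic under $\mathrm{Hom}(G,-)$ for every Gorenstein-projective module $G$. Dually, a proper Gorenstein-injective coresolution of a module $N$ is an acyclic complex $0\to N\to R^0\to R^1\to\cdots$ with all $R^i$ Gorenstein-injective which stays acyclic under $\mathrm{Hom}(-,R)$ for every Gorenstein-injective module $R$. Both are unique up to homotopy equivalence, and morphisms of modules lift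 to them uniquely up to homotopy. For $n\ge 0$ put $$\mathrm{Ext}^n_{\mathrm{GP}}(M,N)=H^n(\mathrm{Hom}(G_M^\bullet,N)),\qquad \mathrm{Ext}^n_{\mathrm{GI}}(M,N)=H^n(\mathrm{Hom}(M,R_N^\bullet)),$$ where $G_M^\bullet\to M$ is a proper Gorenstein-projective resolution and $N\to R_N^\bullet$ is a proper Gorenstein-injective coresolution; these groups are functorial in $M$ and $N$. A module $M$ has finite Gorenstein-projective dimension if it has a proper Gorenstein-projective resolution and $\mathrm{GP.dim}\,M=\sup\{n\ge 0\mid \mathrm{Ext}^n_{\mathrm{GP}}(M,-)\ne 0\}$ is finite; a module $N$ has finite Gorenstein-injective dimension if it has a proper Gorenstein-injective coresolution and $\mathrm{GI.dim}\,N=\sup\{n\ge 0\mid \mathrm{Ext}^n_{\mathrm{GI}}(-,N)\ne 0\}$ is finite. (Over an artin algebra such a resolution and such a coresolution in fact exist for every module.) Theorem (Holm). For each $n\ge 0$ there are isomorphisms of abelian groups $$\mathrm{Ext}^n_{\mathrm{GP}}(M,N)\;\cong\;\mathrm{Ext}^n_{\mathrm{GI}}(M,N)$$ for all modules $M$ of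 finite Gorenstein-projective dimension and all modules $N$ of finite Gorenstein-injective dimension, and these isomorphisms are natural in both $M$ and $N$. -/

import Mathlib

open CategoryTheory Limits Opposite

universe u v w

namespace GorensteinHom

noncomputable section

section HomComplexes

variable {C : Type u} [Category.{v} C] [Preadditive C] {ι : Type w} (c : ComplexShape ι)

/-- The covariant Hom complex `Hom(M, K)` of abelian groups, as a functor in `M` and `K`: in degree
`i` it is the group of morphisms `M ⟶ K.X i`, with the differential given by composition. -/
def homFrom : Cᵒᵖ ⥤ HomologicalComplex C c ⥤ HomologicalComplex AddCommGrpCat.{v} c where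
  obj M := (preadditiveCoyoneda.obj M).mapHomologicalComplex c
  map f := NatTrans.mapHomologicalComplex (preadditiveCoyoneda.map f) c

/-- The contravariant Hom complex `Hom(K, N)` of abelian groups, as a functor in `K` and `N`: in
degree `i` it is the group of morphisms `K.X i ⟶ N`, with the differential given by composition;
the differentials go in the opposite direction, hence the reversed complex shape `c.symm`. -/
def homTo : (HomologicalComplex C c)ᵒᵖ ⥤ C ⥤ HomologicalComplex AddCommGrpCat.{v} c.symm where
  obj K :=
    { obj := fun N => ((preadditiveYoneda.obj N).mapHomologicalComplex c.symm).obj K.unop.op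
      map := fun g =>
        (NatTrans.mapHomologicalComplex (preadditiveYoneda.map g) c.symm).app K.unop.op
      map_id := fun N => by
        simp only [CategoryTheory.Functor.map_id, NatTrans.mapHomologicalComplex_id]; rfl
      map_comp := fun f g => by
        simp only [Functor.map_comp, NatTrans.mapHomologicalComplex_comp]; rfl }
  map f :=
    { app := fun N => ((preadditiveYoneda.obj N).mapHomologicalComplex c.symm).map
        ((HomologicalComplex.opFunctor C c).map f)
      naturality := fun _ _ g =>
        ((NatTrans.mapHomologicalComplex (preadditiveYoneda.map g) c.symm).naturality _).symm }
  map_id K := by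
    ext N : 2
    exact (((preadditiveYoneda.obj N).mapHomologicalComplex c.symm).congr_map
      ((HomologicalComplex.opFunctor C c).map_id K)).trans (CategoryTheory.Functor.map_id _ _)
  map_comp f g := by
    ext N : 2
    exact (((preadditiveYoneda.obj N).mapHomologicalComplex c.symm).congr_map
      ((HomologicalComplex.opFunctor C c).map_comp f g)).trans (Functor.map_comp _ _ _)

variable {c}

theorem exists_lift_of_acyclic {G : C} {K : HomologicalComplex C c}
    (h : (((homFrom c).obj (op G)).obj K).Acyclic) {i j k : ι} (hi : c.prev j = i)
    (hk : c.next j = k) (a : G ⟶ K.X j) (ha : a ≫ K.d j k = 0) :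
    ∃ b : G ⟶ K.X i, b ≫ K.d i j = a := by
  have h' := (HomologicalComplex.exactAt_iff' _ i j k hi hk).1 (h j)
  rw [ShortComplex.ab_exact_iff] at h'
  exact h' a ha

theorem exists_ext_of_acyclic {G : C} {K : HomologicalComplex C c}
    (h : (((homTo c).obj (op K)).obj G).Acyclic) {i j k : ι} (hi : c.prev j = i)
    (hk : c.next j = k) (a : K.X j ⟶ G) (ha : K.d i j ≫ a = 0) :
    ∃ b : K.X k ⟶ G, K.d j k ≫ b = a := by
  have h' := (HomologicalComplex.exactAt_iff' _ k j i
    (show c.symm.prev j = k from hk) (show c.symm.next j = i from hi)).1 (h j)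
  rw [ShortComplex.ab_exact_iff] at h'
  exact h' a ha

theorem homologyMap_homTo_eq {K L : HomologicalComplex C c} {f g : K ⟶ L} (h : Homotopy f g)
    (N : C) (n : ι) :
    HomologicalComplex.homologyMap (((homTo c).map f.op).app N) n =
      HomologicalComplex.homologyMap (((homTo c).map g.op).app N) n :=
  ((preadditiveYoneda.obj N).mapHomotopy h.op).homologyMap_eq n

theorem homologyMap_homFrom_eq {K L : HomologicalComplex C c} {f g : K ⟶ L} (h : Homotopy f g)
    (M : Cᵒᵖ) (n : ι) :
    HomologicalComplex.homologyMap (((homFrom c).obj M).map f) n =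
      HomologicalComplex.homologyMap (((homFrom c).obj M).map g) n :=
  ((preadditiveCoyoneda.obj M).mapHomotopy h).homologyMap_eq n

end HomComplexes

section Relative

variable {C : Type u} [Category.{v} C] [Abelian C] (X : ObjectProperty C)

/-- A proper left resolution `⋯ ⟶ G₁ ⟶ G₀ ⟶ M ⟶ 0` of `M` by objects of `X`: the augmented complex
is acyclic, and it stays acyclic under `Hom(G, -)` for every `G` in `X`. -/
structure ProperResolution (M : C) where
  /-- the complex `⋯ ⟶ G₁ ⟶ G₀` -/
  complex : ChainComplex C ℕ
  /-- the augmentation `G₀ ⟶ M` -/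
  π : complex.X 0 ⟶ M
  d_π : complex.d 1 0 ≫ π = 0
  mem : ∀ i, X (complex.X i)
  acyclic : (complex.augment π d_π).Acyclic
  proper : ∀ G : C, X G → (((homFrom _).obj (op G)).obj (complex.augment π d_π)).Acyclic

/-- A proper right coresolution `0 ⟶ N ⟶ R⁰ ⟶ R¹ ⟶ ⋯` of `N` by objects of `X`: the augmented
complex is acyclic, and it stays acyclic under `Hom(-, G)` for every `G` in `X`. -/
structure ProperCoresolution (N : C) where
  /-- the complex `R⁰ ⟶ R¹ ⟶ ⋯` -/
  complex : CochainComplex C ℕ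
  /-- the coaugmentation `N ⟶ R⁰` -/
  η : N ⟶ complex.X 0
  η_d : η ≫ complex.d 0 1 = 0
  mem : ∀ i, X (complex.X i)
  acyclic : (complex.augment η η_d).Acyclic
  proper : ∀ G : C, X G → (((homTo _).obj (op (complex.augment η η_d))).obj G).Acyclic

variable {X}

namespace ProperResolution

variable {M M' M'' : C}

theorem lift_zero (P : ProperResolution X M) {G : C} (hG : X G) (a : G ⟶ M) :
    ∃ b : G ⟶ P.complex.X 0, b ≫ P.π = a :=
  exists_lift_of_acyclic (P.proper G hG) (i := 1) (j := 0) (k := 0) (by simp) (by simp) a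
    ((congrArg (a ≫ ·) ((P.complex.augment P.π P.d_π).shape 0 0 (by simp))).trans comp_zero)

theorem lift_one (P : ProperResolution X M) {G : C} (hG : X G) (a : G ⟶ P.complex.X 0)
    (ha : a ≫ P.π = 0) : ∃ b : G ⟶ P.complex.X 1, b ≫ P.complex.d 1 0 = a :=
  exists_lift_of_acyclic (P.proper G hG) (i := 2) (j := 1) (k := 0) (by simp) (by simp) a ha

theorem lift_succ (P : ProperResolution X M) {G : C} (hG : X G) (n : ℕ)
    (a : G ⟶ P.complex.X (n + 1)) (ha : a ≫ P.complex.d (n + 1) n = 0) :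
    ∃ b : G ⟶ P.complex.X (n + 2), b ≫ P.complex.d (n + 2) (n + 1) = a :=
  exists_lift_of_acyclic (P.proper G hG) (i := n + 3) (j := n + 2) (k := n + 1)
    (by simp) (by simp) a ha

theorem exists_chainMap (P : ProperResolution X M) (Q : ProperResolution X M') (f : M ⟶ M') :
    ∃ φ : P.complex ⟶ Q.complex, φ.f 0 ≫ Q.π = P.π ≫ f := by
  obtain ⟨z, hz⟩ := Q.lift_zero (P.mem 0) (P.π ≫ f)
  obtain ⟨o, ho⟩ := Q.lift_one (P.mem 1) (P.complex.d 1 0 ≫ z) (by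
    rw [Category.assoc, hz, ← Category.assoc, P.d_π, zero_comp])
  have hs : ∀ (n : ℕ) (g : P.complex.X n ⟶ Q.complex.X n)
      (g' : P.complex.X (n + 1) ⟶ Q.complex.X (n + 1))
      (_ : g' ≫ Q.complex.d (n + 1) n = P.complex.d (n + 1) n ≫ g),
      ∃ g'' : P.complex.X (n + 2) ⟶ Q.complex.X (n + 2),
        g'' ≫ Q.complex.d (n + 2) (n + 1) = P.complex.d (n + 2) (n + 1) ≫ g' :=
    fun n g g' w => Q.lift_succ (P.mem _) n _ (by
      rw [Category.assoc, w, ← Category.assoc, HomologicalComplex.d_comp_d, zero_comp])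
  exact ⟨ChainComplex.mkHom _ _ z o ho fun n p =>
    ⟨(hs n p.1 p.2.1 p.2.2).choose, (hs n p.1 p.2.1 p.2.2).choose_spec⟩, hz⟩

theorem nonempty_homotopy_zero (P : ProperResolution X M) (Q : ProperResolution X M')
    (φ : P.complex ⟶ Q.complex) (h : φ.f 0 ≫ Q.π = 0) : Nonempty (Homotopy φ 0) := by
  obtain ⟨z, hz⟩ := Q.lift_one (P.mem 0) (φ.f 0) h
  obtain ⟨o, ho⟩ := Q.lift_succ (P.mem 1) 0 (φ.f 1 - P.complex.d 1 0 ≫ z) (by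
    rw [Preadditive.sub_comp, Category.assoc, hz, φ.comm, sub_self])
  have hs : ∀ (n : ℕ) (g : P.complex.X n ⟶ Q.complex.X (n + 1))
      (g' : P.complex.X (n + 1) ⟶ Q.complex.X (n + 2))
      (_ : φ.f (n + 1) = P.complex.d (n + 1) n ≫ g + g' ≫ Q.complex.d (n + 2) (n + 1)),
      ∃ g'' : P.complex.X (n + 2) ⟶ Q.complex.X (n + 3),
        φ.f (n + 2) = P.complex.d (n + 2) (n + 1) ≫ g' + g'' ≫ Q.complex.d (n + 3) (n + 2) := by
    intro n g g' w
    obtain ⟨b, hb⟩ := Q.lift_succ (P.mem _) (n + 1)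
      (φ.f (n + 2) - P.complex.d (n + 2) (n + 1) ≫ g') (by simp [w])
    exact ⟨b, by rw [hb]; abel⟩
  exact ⟨Homotopy.mkInductive _ z hz.symm o (by rw [ho]; abel) fun n p =>
    ⟨(hs n p.1 p.2.1 p.2.2).choose, (hs n p.1 p.2.1 p.2.2).choose_spec⟩⟩

theorem nonempty_homotopy (P : ProperResolution X M) (Q : ProperResolution X M')
    (φ ψ : P.complex ⟶ Q.complex) (h : φ.f 0 ≫ Q.π = ψ.f 0 ≫ Q.π) : Nonempty (Homotopy φ ψ) :=
  (nonempty_homotopy_zero P Q (φ - ψ) (by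
    rw [HomologicalComplex.sub_f_apply, Preadditive.sub_comp, h, sub_self])).map
      Homotopy.equivSubZero.invFun

/-- A chosen chain map of proper resolutions over a morphism; it is unique up to homotopy. -/
def lift (P : ProperResolution X M) (Q : ProperResolution X M') (f : M ⟶ M') :
    P.complex ⟶ Q.complex :=
  (exists_chainMap P Q f).choose

theorem lift_π (P : ProperResolution X M) (Q : ProperResolution X M') (f : M ⟶ M') :
    (lift P Q f).f 0 ≫ Q.π = P.π ≫ f :=
  (exists_chainMap P Q f).choose_spec

end ProperResolution

namespace ProperCoresolution

variable {N N' N'' : C}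

theorem ext_zero (P : ProperCoresolution X N) {G : C} (hG : X G) (a : N ⟶ G) :
    ∃ b : P.complex.X 0 ⟶ G, P.η ≫ b = a :=
  exists_ext_of_acyclic (P.proper G hG) (i := 0) (j := 0) (k := 1) (by simp) (by simp) a
    ((congrArg (· ≫ a) ((P.complex.augment P.η P.η_d).shape 0 0 (by simp))).trans zero_comp)

theorem ext_one (P : ProperCoresolution X N) {G : C} (hG : X G) (a : P.complex.X 0 ⟶ G)
    (ha : P.η ≫ a = 0) : ∃ b : P.complex.X 1 ⟶ G, P.complex.d 0 1 ≫ b = a :=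
  exists_ext_of_acyclic (P.proper G hG) (i := 0) (j := 1) (k := 2) (by simp) (by simp) a ha

theorem ext_succ (P : ProperCoresolution X N) {G : C} (hG : X G) (n : ℕ)
    (a : P.complex.X (n + 1) ⟶ G) (ha : P.complex.d n (n + 1) ≫ a = 0) :
    ∃ b : P.complex.X (n + 2) ⟶ G, P.complex.d (n + 1) (n + 2) ≫ b = a :=
  exists_ext_of_acyclic (P.proper G hG) (i := n + 1) (j := n + 2) (k := n + 3)
    (by simp) (by simp) a ha

theorem exists_cochainMap (P : ProperCoresolution X N) (Q : ProperCoresolution X N')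
    (f : N ⟶ N') : ∃ φ : P.complex ⟶ Q.complex, P.η ≫ φ.f 0 = f ≫ Q.η := by
  obtain ⟨z, hz⟩ := P.ext_zero (Q.mem 0) (f ≫ Q.η)
  obtain ⟨o, ho⟩ := P.ext_one (Q.mem 1) (z ≫ Q.complex.d 0 1) (by
    rw [← Category.assoc, hz, Category.assoc, Q.η_d, comp_zero])
  have hs : ∀ (n : ℕ) (g : P.complex.X n ⟶ Q.complex.X n)
      (g' : P.complex.X (n + 1) ⟶ Q.complex.X (n + 1))
      (_ : g ≫ Q.complex.d n (n + 1) = P.complex.d n (n + 1) ≫ g'),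
      ∃ g'' : P.complex.X (n + 2) ⟶ Q.complex.X (n + 2),
        g' ≫ Q.complex.d (n + 1) (n + 2) = P.complex.d (n + 1) (n + 2) ≫ g'' := by
    intro n g g' w
    obtain ⟨b, hb⟩ := P.ext_succ (Q.mem _) n (g' ≫ Q.complex.d (n + 1) (n + 2)) (by
      rw [← Category.assoc, ← w, Category.assoc, HomologicalComplex.d_comp_d, comp_zero])
    exact ⟨b, hb.symm⟩
  exact ⟨CochainComplex.mkHom _ _ z o ho.symm fun n p =>
    ⟨(hs n p.1 p.2.1 p.2.2).choose, (hs n p.1 p.2.1 p.2.2).choose_spec⟩, hz⟩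

theorem nonempty_homotopy_zero (P : ProperCoresolution X N) (Q : ProperCoresolution X N')
    (φ : P.complex ⟶ Q.complex) (h : P.η ≫ φ.f 0 = 0) : Nonempty (Homotopy φ 0) := by
  obtain ⟨z, hz⟩ := P.ext_one (Q.mem 0) (φ.f 0) h
  obtain ⟨o, ho⟩ := P.ext_succ (Q.mem 1) 0 (φ.f 1 - z ≫ Q.complex.d 0 1) (by
    rw [Preadditive.comp_sub, ← Category.assoc, hz, ← φ.comm, sub_self])
  have hs : ∀ (n : ℕ) (g : P.complex.X (n + 1) ⟶ Q.complex.X n)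
      (g' : P.complex.X (n + 2) ⟶ Q.complex.X (n + 1))
      (_ : φ.f (n + 1) = g ≫ Q.complex.d n (n + 1) + P.complex.d (n + 1) (n + 2) ≫ g'),
      ∃ g'' : P.complex.X (n + 3) ⟶ Q.complex.X (n + 2),
        φ.f (n + 2) = g' ≫ Q.complex.d (n + 1) (n + 2) + P.complex.d (n + 2) (n + 3) ≫ g'' := by
    intro n g g' w
    obtain ⟨b, hb⟩ := P.ext_succ (Q.mem _) (n + 1)
      (φ.f (n + 2) - g' ≫ Q.complex.d (n + 1) (n + 2)) (by
        rw [Preadditive.comp_sub, ← φ.comm, w]; simp)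
    exact ⟨b, by rw [hb]; abel⟩
  exact ⟨Homotopy.mkCoinductive _ z hz.symm o (by rw [ho]; abel) fun n p =>
    ⟨(hs n p.1 p.2.1 p.2.2).choose, (hs n p.1 p.2.1 p.2.2).choose_spec⟩⟩

theorem nonempty_homotopy (P : ProperCoresolution X N) (Q : ProperCoresolution X N')
    (φ ψ : P.complex ⟶ Q.complex) (h : P.η ≫ φ.f 0 = P.η ≫ ψ.f 0) : Nonempty (Homotopy φ ψ) :=
  (nonempty_homotopy_zero P Q (φ - ψ) (by
    rw [HomologicalComplex.sub_f_apply, Preadditive.comp_sub, h, sub_self])).map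
      Homotopy.equivSubZero.invFun

/-- A chosen cochain map of proper coresolutions over a morphism; it is unique up to homotopy. -/
def lift (P : ProperCoresolution X N) (Q : ProperCoresolution X N') (f : N ⟶ N') :
    P.complex ⟶ Q.complex :=
  (exists_cochainMap P Q f).choose

theorem η_lift (P : ProperCoresolution X N) (Q : ProperCoresolution X N') (f : N ⟶ N') :
    P.η ≫ (lift P Q f).f 0 = f ≫ Q.η :=
  (exists_cochainMap P Q f).choose_spec

end ProperCoresolution

variable (X)

/-- The objects that admit a proper left resolution by objects of `X`. -/
def HasProperResolution : ObjectProperty C := fun M => Nonempty (ProperResolution X M)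

/-- The objects that admit a proper right coresolution by objects of `X`. -/
def HasProperCoresolution : ObjectProperty C := fun N => Nonempty (ProperCoresolution X N)

/-- A chosen proper resolution. -/
def properResolution (M : (HasProperResolution X).FullSubcategory) : ProperResolution X M.obj :=
  M.property.some

/-- A chosen proper coresolution. -/
def properCoresolution (N : (HasProperCoresolution X).FullSubcategory) :
    ProperCoresolution X N.obj :=
  N.property.some

/-- The relative extension groups `Hⁿ(Hom(G_M, N))`, where `G_M ⟶ M` is a proper left resolution by
objects of `X`, as a functor in both variables. -/
def extOfResolution (n : ℕ) :
    (HasProperResolution X).FullSubcategoryᵒᵖ ⥤ C ⥤ AddCommGrpCat.{v} where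
  obj M := (homTo _).obj (op (properResolution X M.unop).complex) ⋙
    HomologicalComplex.homologyFunctor _ _ n
  map f := Functor.whiskerRight
    ((homTo _).map (ProperResolution.lift _ _ f.unop.hom).op) _
  map_id M := by
    ext N : 2
    obtain ⟨h⟩ := ProperResolution.nonempty_homotopy _ _
      (ProperResolution.lift (properResolution X M.unop) (properResolution X M.unop) (𝟙 _))
      (𝟙 _) (by rw [ProperResolution.lift_π]; simp)
    refine (homologyMap_homTo_eq h N n).trans ?_
    rw [op_id, CategoryTheory.Functor.map_id]
    exact HomologicalComplex.homologyMap_id _ _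
  map_comp {M₁ M₂ M₃} f g := by
    ext N : 2
    obtain ⟨h⟩ := ProperResolution.nonempty_homotopy _ _
      (ProperResolution.lift (properResolution X M₃.unop) (properResolution X M₁.unop)
        (g.unop.hom ≫ f.unop.hom))
      (ProperResolution.lift _ (properResolution X M₂.unop) g.unop.hom ≫
        ProperResolution.lift _ _ f.unop.hom) (by
          rw [ProperResolution.lift_π, HomologicalComplex.comp_f, Category.assoc,
            ProperResolution.lift_π, ← Category.assoc, ← Category.assoc,
            ProperResolution.lift_π])
    refine (homologyMap_homTo_eq h N n).trans ?_
    rw [op_comp, Functor.map_comp]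
    exact HomologicalComplex.homologyMap_comp _ _ _

/-- The relative extension groups `Hⁿ(Hom(M, R_N))`, where `N ⟶ R_N` is a proper right coresolution
by objects of `X`, as a functor in both variables. -/
def extOfCoresolution (n : ℕ) :
    Cᵒᵖ ⥤ (HasProperCoresolution X).FullSubcategory ⥤ AddCommGrpCat.{v} where
  obj M :=
    { obj := fun N => (((homFrom _).obj M).obj (properCoresolution X N).complex).homology n
      map := fun g => HomologicalComplex.homologyMap
        (((homFrom _).obj M).map (ProperCoresolution.lift _ _ g.hom)) n
      map_id := fun N => by
        obtain ⟨h⟩ := ProperCoresolution.nonempty_homotopy _ _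
          (ProperCoresolution.lift (properCoresolution X N) (properCoresolution X N) (𝟙 _))
          (𝟙 _) (by rw [ProperCoresolution.η_lift]; simp)
        refine (homologyMap_homFrom_eq h M n).trans ?_
        rw [CategoryTheory.Functor.map_id]
        exact HomologicalComplex.homologyMap_id _ _
      map_comp := fun {N₁ N₂ N₃} f g => by
        obtain ⟨h⟩ := ProperCoresolution.nonempty_homotopy _ _
          (ProperCoresolution.lift (properCoresolution X N₁) (properCoresolution X N₃)
            (f.hom ≫ g.hom))
          (ProperCoresolution.lift _ (properCoresolution X N₂) f.hom ≫
            ProperCoresolution.lift _ _ g.hom) (by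
              rw [ProperCoresolution.η_lift, HomologicalComplex.comp_f, ← Category.assoc,
                ProperCoresolution.η_lift, Category.assoc, Category.assoc,
                ProperCoresolution.η_lift])
        refine (homologyMap_homFrom_eq h M n).trans ?_
        rw [Functor.map_comp]
        exact HomologicalComplex.homologyMap_comp _ _ _ }
  map f :=
    { app := fun N => HomologicalComplex.homologyMap
        (((homFrom _).map f).app (properCoresolution X N).complex) n
      naturality := fun N₁ N₂ g => by
        dsimp only
        rw [← HomologicalComplex.homologyMap_comp, ← HomologicalComplex.homologyMap_comp,
          NatTrans.naturality] }
  map_id M := by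
    ext N : 2
    dsimp only
    rw [CategoryTheory.Functor.map_id]
    exact HomologicalComplex.homologyMap_id _ _
  map_comp f g := by
    ext N : 2
    dsimp only
    rw [Functor.map_comp]
    exact HomologicalComplex.homologyMap_comp _ _ _

end Relative

section Gorenstein

variable (A : Type u) [Ring A]

/-- `M` is Gorenstein-projective: it is the zeroth cocycle of a totally acyclic complex, i.e. of an
acyclic complex of projective modules which stays acyclic under `Hom(-, Q)` for each projective
module `Q`. The modules need not be finitely generated. -/
def GorensteinProjective : ObjectProperty (ModuleCat.{u} A) := fun M =>
  ∃ P : CochainComplex (ModuleCat.{u} A) ℤ,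
    (∀ i, Projective (P.X i)) ∧ P.Acyclic ∧
    (∀ Q : ModuleCat.{u} A, Projective Q → (((homTo _).obj (op P)).obj Q).Acyclic) ∧
    Nonempty (P.cycles 0 ≅ M)

/-- `N` is Gorenstein-injective: it is the zeroth coboundary of a cototally acyclic complex, i.e. of
an acyclic complex of injective modules which stays acyclic under `Hom(J, -)` for each injective
module `J`. The modules need not be finitely generated. -/
def GorensteinInjective : ObjectProperty (ModuleCat.{u} A) := fun N =>
  ∃ I : CochainComplex (ModuleCat.{u} A) ℤ,
    (∀ i, Injective (I.X i)) ∧ I.Acyclic ∧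
    (∀ J : ModuleCat.{u} A, Injective J → (((homFrom _).obj (op J)).obj I).Acyclic) ∧
    Nonempty (image (I.d (-1) 0) ≅ N)

/-- The modules that admit a proper Gorenstein-projective resolution. -/
abbrev GPResolvable : ObjectProperty (ModuleCat.{u} A) :=
  HasProperResolution (GorensteinProjective A)

/-- The modules that admit a proper Gorenstein-injective coresolution. -/
abbrev GIResolvable : ObjectProperty (ModuleCat.{u} A) :=
  HasProperCoresolution (GorensteinInjective A)

/-- The GP-extension groups `Ext_GPⁿ(M, N) = Hⁿ(Hom(G_M, N))`, with `G_M ⟶ M` a proper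
Gorenstein-projective resolution, as a functor in both variables. -/
abbrev extGP (n : ℕ) :
    (GPResolvable A).FullSubcategoryᵒᵖ ⥤ ModuleCat.{u} A ⥤ AddCommGrpCat.{u} :=
  extOfResolution (GorensteinProjective A) n

/-- The GI-extension groups `Ext_GIⁿ(M, N) = Hⁿ(Hom(M, R_N))`, with `N ⟶ R_N` a proper
Gorenstein-injective coresolution, as a functor in both variables. -/
abbrev extGI (n : ℕ) :
    (ModuleCat.{u} A)ᵒᵖ ⥤ (GIResolvable A).FullSubcategory ⥤ AddCommGrpCat.{u} :=
  extOfCoresolution (GorensteinInjective A) n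

variable {A}

/-- The Gorenstein-projective dimension `sup {n ≥ 0 | Ext_GPⁿ(M, -) ≠ 0}`. -/
def gpDim (M : (GPResolvable A).FullSubcategory) : ℕ∞ :=
  ⨆ (n : ℕ) (_ : ∃ N, ¬ IsZero (((extGP A n).obj (op M)).obj N)), (n : ℕ∞)

/-- The Gorenstein-injective dimension `sup {n ≥ 0 | Ext_GIⁿ(-, N) ≠ 0}`. -/
def giDim (N : (GIResolvable A).FullSubcategory) : ℕ∞ :=
  ⨆ (n : ℕ) (_ : ∃ M, ¬ IsZero (((extGI A n).obj M).obj N)), (n : ℕ∞)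

variable (A)

/-- The modules of finite Gorenstein-projective dimension. -/
def FiniteGPDim : ObjectProperty (ModuleCat.{u} A) := fun M =>
  ∃ h : GPResolvable A M, gpDim ⟨M, h⟩ < ⊤

/-- The modules of finite Gorenstein-injective dimension. -/
def FiniteGIDim : ObjectProperty (ModuleCat.{u} A) := fun N =>
  ∃ h : GIResolvable A N, giDim ⟨N, h⟩ < ⊤

theorem finiteGPDim_le : FiniteGPDim A ≤ GPResolvable A := fun _ h => h.1

theorem finiteGIDim_le : FiniteGIDim A ≤ GIResolvable A := fun _ h => h.1

/-- `Ext_GPⁿ(M, N)` as a functor in `M` of finite Gorenstein-projective dimension and `N` of finite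
Gorenstein-injective dimension. -/
def extGPFinite (n : ℕ) :
    (FiniteGPDim A).FullSubcategoryᵒᵖ ⥤ (FiniteGIDim A).FullSubcategory ⥤ AddCommGrpCat.{u} :=
  (ObjectProperty.ιOfLE (finiteGPDim_le A)).op ⋙ extGP A n ⋙
    (Functor.whiskeringLeft _ _ _).obj (FiniteGIDim A).ι

/-- `Ext_GIⁿ(M, N)` as a functor in `M` of finite Gorenstein-projective dimension and `N` of finite
Gorenstein-injective dimension. -/
def extGIFinite (n : ℕ) :
    (FiniteGPDim A).FullSubcategoryᵒᵖ ⥤ (FiniteGIDim A).FullSubcategory ⥤ AddCommGrpCat.{u} :=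
  (FiniteGPDim A).ι.op ⋙ extGI A n ⋙
    (Functor.whiskeringLeft _ _ _).obj (ObjectProperty.ιOfLE (finiteGIDim_le A))

end Gorenstein

end

end GorensteinHom

/-! Both extension groups are compared through the double complex Hom(Gₚ, Rq), with G a proper
Gorenstein-projective resolution of M and R a proper Gorenstein-injective coresolution of N. If its
augmented rows and columns are exact, staircases of elements join the cocycles of Hom(G, N) to those
of Hom(M, R) and match coboundaries (`ExactBicomplex.exists_linked`,
`ExactBicomplex.Linked.exists_eq`), which gives the isomorphism. Chain maps carry staircases to
staircases (`StaircaseRel.map`), which gives naturality.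

The substance is the exactness: G → M must stay exact under Hom(-, R) for every Gorenstein-injective
R (`acyclic_homTo_of_gorensteinInjective`), and dually. Vanishing of Ext_GPⁿ(M, -) for large n
splits the late syzygy sequences, so late syzygies are direct summands of Gorenstein-projectives,
hence Gorenstein-projective (`InTotallyAcyclicClass.of_retract`). Going back along the resolution,
pushouts give each syzygy Z an approximation 0 → H → G' → Z → 0 with G' Gorenstein-projective and H
of finite projective dimension (`HasApproximation.of_ses`). Now compare it with the proper
presentation 0 → K → G₀ → Z → 0. Up to maps factoring through K → G₀, the identity of K factors
through H. Since H has no higher extensions into Gorenstein-injectives, every map H → R factors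
through an injective and so extends to G'. Hence every map K → R extends to G₀
(`HasApproximation.exists_ext`).

The injective half is the same argument in the opposite category: N is Gorenstein-injective exactly
when `op N` satisfies the categorical form of Gorenstein-projectivity. -/

namespace GorensteinHom

open Abelian

open scoped ZeroObject

/-! ### Short exact sequences, pushouts and duality in abelian categories -/

section ShortExactSequences

variable {C : Type u} [Category.{v} C] [Abelian C]

/-- The sequence `0 ⟶ X ⟶ Y ⟶ Z ⟶ 0` given by `f` and `g` is short exact. -/
def SES {X Y Z : C} (f : X ⟶ Y) (g : Y ⟶ Z) : Prop :=
  ∃ w : f ≫ g = 0, (ShortComplex.mk f g w).ShortExact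

namespace SES

variable {X Y Z W : C} {f : X ⟶ Y} {g : Y ⟶ Z}

theorem mono (h : SES f g) : Mono f := h.2.mono_f

theorem epi (h : SES f g) : Epi g := h.2.epi_g

theorem desc (h : SES f g) (k : Y ⟶ W) (hk : f ≫ k = 0) : ∃ l : Z ⟶ W, g ≫ l = k :=
  have := h.epi
  h.2.exact.desc' k hk

theorem lift (h : SES f g) (k : W ⟶ Y) (hk : k ≫ g = 0) : ∃ l : W ⟶ X, l ≫ f = k :=
  have := h.mono
  h.2.exact.lift' k hk

theorem of_desc [Mono f] [Epi g] (w : f ≫ g = 0)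
    (h : ∀ (W : C) (k : Y ⟶ W), f ≫ k = 0 → ∃ l : Z ⟶ W, g ≫ l = k) : SES f g :=
  ⟨w, { exact := (ShortComplex.mk f g w).exact_of_g_is_cokernel
          (CokernelCofork.IsColimit.ofπ' g w fun k hk => ⟨(h _ k hk).choose, (h _ k hk).choose_spec⟩) }⟩

theorem op (h : SES f g) : SES g.op f.op := ⟨by rw [← op_comp, h.1, op_zero], h.2.op⟩

theorem unop {X Y Z : Cᵒᵖ} {f : X ⟶ Y} {g : Y ⟶ Z} (h : SES f g) : SES g.unop f.unop :=
  ⟨by rw [← unop_comp, h.1, unop_zero], h.2.unop⟩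

theorem of_cokernel (f : X ⟶ Y) [Mono f] : SES f (cokernel.π f) :=
  of_desc (cokernel.condition f) fun _ k hk => ⟨cokernel.desc f k hk, by simp⟩

/-- The pushout of a short exact sequence along a morphism out of its left term. -/
theorem pushout (h : SES f g) {X' Y' : C} {a : X ⟶ X'} {f' : X' ⟶ Y'} {b : Y ⟶ Y'}
    (hp : IsPushout f a b f') : ∃ g' : Y' ⟶ Z, b ≫ g' = g ∧ SES f' g' := by
  have := h.mono
  have := h.epi
  have hb : b ≫ hp.desc g 0 (by rw [h.1, comp_zero]) = g := hp.inl_desc _ _ _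
  have hf : f' ≫ hp.desc g 0 (by rw [h.1, comp_zero]) = 0 := hp.inr_desc _ _ _
  have : Mono f' := (MorphismProperty.monomorphisms C).of_isPushout hp.flip (by
    simpa using ‹Mono f›)
  have : Epi (hp.desc g 0 (by rw [h.1, comp_zero])) := epi_of_epi_fac hb
  refine ⟨_, hb, of_desc hf fun T k hk => ?_⟩
  obtain ⟨l, hl⟩ := h.desc (b ≫ k) (by
    rw [← Category.assoc, hp.w, Category.assoc, hk, comp_zero])
  refine ⟨l, hp.hom_ext ?_ ?_⟩
  · rw [← Category.assoc, hb, hl]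
  · rw [← Category.assoc, hf, zero_comp, hk]

/-- Pushing out a monomorphism along the cokernel of `f` gives the cokernel of the composite. -/
theorem comp_mono (h : SES f g) {Y' Z' : C} {j : Y ⟶ Y'} [Mono j] {b : Y' ⟶ Z'} {j' : Z ⟶ Z'}
    (hp : IsPushout j g b j') : SES (f ≫ j) b := by
  have := h.mono
  have := h.epi
  have : Epi b := (MorphismProperty.epimorphisms C).of_isPushout hp (by simpa using ‹Epi g›)
  refine of_desc (by rw [Category.assoc, hp.w, ← Category.assoc, h.1, zero_comp]) fun T k hk => ?_
  obtain ⟨l, hl⟩ := h.desc (j ≫ k) (by rwa [Category.assoc] at hk)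
  exact ⟨hp.desc k l hl.symm, hp.inl_desc _ _ _⟩

/-- A monomorphism of short exact sequences has a short exact cokernel. -/
theorem exists_cokernel (h : SES f g) {X' Y' Z' X'' Z'' : C} {f' : X' ⟶ Y'} {g' : Y' ⟶ Z'}
    (h' : SES f' g') {a : X ⟶ X'} {b : Y ⟶ Y'} {c : Z ⟶ Z'} (hf : f ≫ b = a ≫ f')
    (hg : g ≫ c = b ≫ g') {p : X' ⟶ X''} {r : Z' ⟶ Z''} (ha : SES a p) (hc : SES c r) :
    ∃ (Y'' : C) (q : Y' ⟶ Y'') (f'' : X'' ⟶ Y'') (g'' : Y'' ⟶ Z''), SES b q ∧ SES f'' g'' := by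
  have := h.epi
  have := h'.epi
  have := ha.mono
  have := hc.mono
  have := ha.epi
  have := hc.epi
  have := h'.mono
  have : Mono b := by
    refine Preadditive.mono_of_cancel_zero _ fun {T} t ht => ?_
    obtain ⟨s, rfl⟩ := h.lift t (by
      rw [← cancel_mono c, Category.assoc, hg, ← Category.assoc, ht, zero_comp, zero_comp])
    have hs : s = 0 := by
      rw [← cancel_mono a, ← cancel_mono f', Category.assoc, ← hf, ← Category.assoc, ht, zero_comp,
        zero_comp]
    rw [hs, zero_comp]
  have hb := of_cokernel b
  have := hb.epi
  obtain ⟨f'', hf''⟩ := ha.desc (f' ≫ cokernel.π b) (by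
    rw [← Category.assoc, ← hf, Category.assoc, hb.1, comp_zero])
  obtain ⟨g'', hg''⟩ := hb.desc (g' ≫ r) (by
    rw [← Category.assoc, ← hg, Category.assoc, hc.1, comp_zero])
  have : Epi g'' := epi_of_epi_fac hg''
  have : Mono f'' := by
    refine Preadditive.mono_of_cancel_zero _ fun {T} t ht => ?_
    -- Diagram chase with generalized elements: `t` lifts along `p` only after precomposition with
    -- an epimorphism.
    obtain ⟨T', π, _, x, hx⟩ := surjective_up_to_refinements_of_epi p t
    obtain ⟨y, hy⟩ := hb.lift (x ≫ f') (by
      rw [Category.assoc, ← hf'', ← Category.assoc, ← hx, Category.assoc, ht, comp_zero])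
    obtain ⟨z, rfl⟩ := h.lift y (by
      rw [← cancel_mono c, Category.assoc, hg, ← Category.assoc, hy, Category.assoc, h'.1,
        comp_zero, zero_comp])
    have hz : z ≫ a = x := by
      rw [← cancel_mono f', Category.assoc, ← hf, ← Category.assoc, hy]
    rw [← cancel_epi π, hx, ← hz, Category.assoc, ha.1, comp_zero, comp_zero]
  refine ⟨_, _, f'', g'', hb, of_desc ?_ fun T k hk => ?_⟩
  · rw [← cancel_epi p, ← Category.assoc, hf'', Category.assoc, hg'', ← Category.assoc, h'.1,
      zero_comp, comp_zero]
  · obtain ⟨m, hm⟩ := h'.desc (cokernel.π b ≫ k) (by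
      rw [← Category.assoc, ← hf'', Category.assoc, hk, comp_zero])
    obtain ⟨l, rfl⟩ := hc.desc m (by
      rw [← cancel_epi g, ← Category.assoc, hg, Category.assoc, hm, ← Category.assoc, hb.1,
        zero_comp, comp_zero])
    refine ⟨l, ?_⟩
    rw [← cancel_epi (cokernel.π b), ← Category.assoc, hg'', Category.assoc, hm]

end SES

/-! ### Lifting, extending and dimension shifting by vanishing of Ext -/

section ExtGroups

variable {C : Type u} [Category.{v} C] [Abelian C] [HasExt.{w} C]

namespace SES

variable {X Y Z W : C} {f : X ⟶ Y} {g : Y ⟶ Z}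

theorem exists_ext (h : SES f g) [hW : Subsingleton (Ext.{w} Z W 1)] (a : X ⟶ W) :
    ∃ b : Y ⟶ W, f ≫ b = a := by
  obtain ⟨x, hx⟩ := Ext.contravariant_sequence_exact₁ h.2 _ (Ext.mk₀ a) (n₁ := 1) rfl
    (hW.elim _ _)
  obtain ⟨b, rfl⟩ := (Ext.mk₀_bijective _ _).2 x
  exact ⟨b, (Ext.mk₀_bijective _ _).1 (by rw [← Ext.mk₀_comp_mk₀]; exact hx)⟩

theorem exists_lift (h : SES f g) [hW : Subsingleton (Ext.{w} W X 1)] (a : W ⟶ Z) :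
    ∃ b : W ⟶ Y, b ≫ g = a := by
  obtain ⟨x, hx⟩ := Ext.covariant_sequence_exact₃ _ h.2 (Ext.mk₀ a) (n₁ := 1) rfl
    (hW.elim _ _)
  obtain ⟨b, rfl⟩ := (Ext.mk₀_bijective _ _).2 x
  exact ⟨b, (Ext.mk₀_bijective _ _).1 (by rw [← Ext.mk₀_comp_mk₀]; exact hx)⟩

/-- As Ext¹(Y, W) vanishes, every class in Ext¹(Z, W) is the pushforward of the class of the
sequence along some X ⟶ W, and this pushforward is zero once the map extends to Y. -/
theorem subsingleton_ext_one (h : SES f g) [hY : Subsingleton (Ext.{w} Y W 1)]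
    (H : ∀ a : X ⟶ W, ∃ b, f ≫ b = a) : Subsingleton (Ext.{w} Z W 1) := by
  refine subsingleton_of_forall_eq 0 fun x => ?_
  obtain ⟨y, rfl⟩ := Ext.contravariant_sequence_exact₃ h.2 _ x (hY.elim _ _) (n₀ := 0) rfl
  obtain ⟨a, rfl⟩ := (Ext.mk₀_bijective _ _).2 y
  obtain ⟨b, rfl⟩ := H a
  rw [← Ext.mk₀_comp_mk₀]
  exact h.2.extClass_comp_assoc _

theorem subsingleton_ext_left (h : SES f g) (n : ℕ) [hY : Subsingleton (Ext.{w} Y W n)]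
    [hZ : Subsingleton (Ext.{w} Z W (n + 1))] : Subsingleton (Ext.{w} X W n) := by
  refine subsingleton_of_forall_eq 0 fun x => ?_
  obtain ⟨y, rfl⟩ := Ext.contravariant_sequence_exact₁ h.2 _ x (n₁ := n + 1) (add_comm _ _)
    (hZ.elim _ _)
  rw [hY.elim y 0, Ext.comp_zero]

theorem subsingleton_ext_middle (h : SES f g) (n : ℕ) [hX : Subsingleton (Ext.{w} X W n)]
    [hZ : Subsingleton (Ext.{w} Z W n)] : Subsingleton (Ext.{w} Y W n) := by
  refine subsingleton_of_forall_eq 0 fun x => ?_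
  obtain ⟨y, rfl⟩ := Ext.contravariant_sequence_exact₂ h.2 _ x (hX.elim _ _)
  rw [hZ.elim y 0, Ext.comp_zero]

theorem subsingleton_ext_right (h : SES f g) (n : ℕ) [hX : Subsingleton (Ext.{w} X W n)]
    [hY : Subsingleton (Ext.{w} Y W (n + 1))] : Subsingleton (Ext.{w} Z W (n + 1)) := by
  refine subsingleton_of_forall_eq 0 fun x => ?_
  obtain ⟨y, rfl⟩ := Ext.contravariant_sequence_exact₃ h.2 _ x (hY.elim _ _) (n₀ := n)
    (add_comm _ _)
  rw [hX.elim y 0, Ext.comp_zero]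

theorem subsingleton_ext_to_right (h : SES f g) (n : ℕ) [hY : Subsingleton (Ext.{w} W Y n)]
    [hX : Subsingleton (Ext.{w} W X (n + 1))] : Subsingleton (Ext.{w} W Z n) := by
  refine subsingleton_of_forall_eq 0 fun x => ?_
  obtain ⟨y, rfl⟩ := Ext.covariant_sequence_exact₃ _ h.2 x (n₁ := n + 1) rfl (hX.elim _ _)
  rw [hY.elim y 0, Ext.zero_comp]

end SES

theorem subsingleton_ext_of_retract {X Y W : C} {i : X ⟶ Y} {r : Y ⟶ X} (h : i ≫ r = 𝟙 X) (n : ℕ)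
    [hY : Subsingleton (Ext.{w} Y W n)] : Subsingleton (Ext.{w} X W n) := by
  refine subsingleton_of_forall_eq 0 fun x => ?_
  rw [← Ext.mk₀_id_comp x, ← h, ← Ext.mk₀_comp_mk₀_assoc,
    hY.elim ((Ext.mk₀ r).comp x (zero_add n)) 0, Ext.comp_zero]

end ExtGroups

end ShortExactSequences

namespace SES

variable {C : Type u} [Category.{v} C] [Abelian C]

theorem of_kernel {X Y : C} (g : X ⟶ Y) [Epi g] : SES (kernel.ι g) g :=
  ⟨kernel.condition g, { exact := ShortComplex.exact_of_f_is_kernel _ (kernelIsKernel g) }⟩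

theorem biprod (X Y : C) : SES (biprod.inl : X ⟶ X ⊞ Y) biprod.snd :=
  of_desc biprod.inl_snd fun _ k hk => ⟨biprod.inr ≫ k, by ext <;> simp [hk]⟩

end SES

/-! ### Gorenstein-projectivity in an abelian category, without complexes -/

section TotallyAcyclic

variable {C : Type u} [Category.{v} C] [Abelian C]

/-- Classes of cocycles of totally acyclic complexes of projectives: each member embeds into a
projective object with cokernel in the class, and is a quotient of a projective object with kernel
in the class, the latter sequence staying exact under `Hom(-, Q)` for projective `Q`. -/
structure IsTotallyAcyclicClass (S : ObjectProperty C) : Prop where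
  right {Y : C} (hY : S Y) :
    ∃ (P Y' : C) (i : Y ⟶ P) (p : P ⟶ Y'), SES i p ∧ Projective P ∧ S Y'
  left {Y : C} (hY : S Y) :
    ∃ (P Y' : C) (i : Y' ⟶ P) (p : P ⟶ Y), SES i p ∧ Projective P ∧ S Y' ∧
      ∀ Q : C, Projective Q → ∀ a : Y' ⟶ Q, ∃ b, i ≫ b = a

/-- The members of classes of cocycles of totally acyclic complexes of projectives. -/
def InTotallyAcyclicClass : ObjectProperty C := fun X =>
  ∃ S : ObjectProperty C, IsTotallyAcyclicClass S ∧ S X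

/-- The union of all such classes is again such a class, so membership can be unfolded indefinitely
in both directions. -/
theorem isTotallyAcyclicClass_inTotallyAcyclicClass :
    IsTotallyAcyclicClass (InTotallyAcyclicClass (C := C)) where
  right := by
    rintro Y ⟨S, hS, hY⟩
    obtain ⟨P, Y', i, p, h, hP, hY'⟩ := hS.right hY
    exact ⟨P, Y', i, p, h, hP, S, hS, hY'⟩
  left := by
    rintro Y ⟨S, hS, hY⟩
    obtain ⟨P, Y', i, p, h, hP, hY', hQ⟩ := hS.left hY
    exact ⟨P, Y', i, p, h, hP, ⟨S, hS, hY'⟩, hQ⟩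

namespace InTotallyAcyclicClass

theorem right {Y : C} (hY : InTotallyAcyclicClass Y) : ∃ (P Y' : C) (i : Y ⟶ P) (p : P ⟶ Y'),
    SES i p ∧ Projective P ∧ InTotallyAcyclicClass Y' :=
  isTotallyAcyclicClass_inTotallyAcyclicClass.right hY

theorem left {Y : C} (hY : InTotallyAcyclicClass Y) : ∃ (P Y' : C) (i : Y' ⟶ P) (p : P ⟶ Y),
    SES i p ∧ Projective P ∧ InTotallyAcyclicClass Y' ∧
      ∀ Q : C, Projective Q → ∀ a : Y' ⟶ Q, ∃ b, i ≫ b = a :=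
  isTotallyAcyclicClass_inTotallyAcyclicClass.left hY

variable [HasExt.{w} C]

/-- The exactness of the left sequence under Hom(-, Q) kills Ext¹; higher degrees follow by
dimension shift, since the kernel stays in the class. -/
theorem subsingleton_ext {X : C} (hX : InTotallyAcyclicClass X) {Q : C} (hQ : Projective Q)
    (n : ℕ) : Subsingleton (Ext.{w} X Q (n + 1)) := by
  induction n generalizing X with
  | zero =>
    obtain ⟨P, Y', i, p, h, hP, hY', H⟩ := hX.left
    have := Ext.subsingleton_of_projective P Q 0
    exact h.subsingleton_ext_one (H Q hQ)
  | succ n ih =>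
    obtain ⟨P, Y', i, p, h, hP, hY', H⟩ := hX.left
    have := Ext.subsingleton_of_projective P Q (n + 1)
    have := ih hY'
    exact h.subsingleton_ext_right _

variable [EnoughProjectives C]

/-- The smallest class containing `S` and closed under kernels of epimorphisms from projectives. -/
inductive SyzygyClosure (S : ObjectProperty C) : C → Prop
  | of {Y : C} (hY : S Y) : SyzygyClosure S Y
  | syzygy {Y P Y' : C} {i : Y ⟶ P} {p : P ⟶ Y'} (h : SES i p) (hP : Projective P)
      (hY' : SyzygyClosure S Y') : SyzygyClosure S Y

/-- With enough projectives, the left half of a totally acyclic complex comes for free when the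
extension groups into projectives vanish. -/
theorem of_right {S : ObjectProperty C}
    (hext : ∀ {Y : C}, S Y → ∀ {Q : C}, Projective Q → ∀ n, Subsingleton (Ext.{w} Y Q (n + 1)))
    (hright : ∀ {Y : C}, S Y → ∃ (P Y' : C) (i : Y ⟶ P) (p : P ⟶ Y'),
      SES i p ∧ Projective P ∧ S Y') {X : C} (hX : S X) : InTotallyAcyclicClass X := by
  have hext' {Y : C} (hY : SyzygyClosure S Y) {Q : C} (hQ : Projective Q) (n : ℕ) :
      Subsingleton (Ext.{w} Y Q (n + 1)) := by
    induction hY generalizing n with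
    | of hY => exact hext hY hQ n
    | @syzygy Y P Y' i p h hP hY' ih =>
      have := Ext.subsingleton_of_projective P Q n
      have := ih (n + 1)
      exact h.subsingleton_ext_left _
  -- Closing under syzygies supplies the left halves and keeps the right ones, since a new member
  -- comes with its embedding into a projective. Exactness under Hom(-, Q) is the vanishing of Ext¹
  -- on the closure.
  refine ⟨SyzygyClosure S, ⟨?_, fun {Y} hY => ?_⟩, .of hX⟩
  · rintro Y (hY | @⟨_, P, Y', i, p, h, hP, hY'⟩)
    · obtain ⟨P, Y', i, p, h, hP, hY'⟩ := hright hY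
      exact ⟨P, Y', i, p, h, hP, .of hY'⟩
    · exact ⟨P, Y', i, p, h, hP, hY'⟩
  · have h := SES.of_kernel (Projective.π Y)
    refine ⟨_, _, _, _, h, inferInstance, .syzygy h inferInstance hY, fun Q hQ a => ?_⟩
    have := hext' hY hQ 0
    exact h.exists_ext a

/-- A horseshoe argument to the right: Ext¹(Z, P) = 0 extends X ⟶ P to Y, so Y embeds into P ⊞ P',
and the cokernel is again an extension of two members. This makes the class of extensions satisfy
`of_right`. -/
theorem extension {X Y Z : C} {f : X ⟶ Y} {g : Y ⟶ Z} (h : SES f g)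
    (hX : InTotallyAcyclicClass X) (hZ : InTotallyAcyclicClass Z) : InTotallyAcyclicClass Y := by
  refine of_right.{_, _, w} (S := fun E => ∃ (X Z : C) (f : X ⟶ E) (g : E ⟶ Z), SES f g ∧
    InTotallyAcyclicClass X ∧ InTotallyAcyclicClass Z) ?_ ?_ ⟨X, Z, f, g, h, hX, hZ⟩
  · rintro E ⟨X, Z, f, g, h, hX, hZ⟩ Q hQ n
    have := hX.subsingleton_ext.{_, _, w} hQ n
    have := hZ.subsingleton_ext.{_, _, w} hQ n
    exact h.subsingleton_ext_middle _
  · rintro E ⟨X, Z, f, g, h, hX, hZ⟩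
    obtain ⟨P, X', i, p, hi, hP, hX'⟩ := hX.right
    obtain ⟨P', Z', i', p', hi', hP', hZ'⟩ := hZ.right
    have := hZ.subsingleton_ext.{_, _, w} hP 0
    obtain ⟨e, he⟩ := h.exists_ext i
    obtain ⟨F, q, f'', g'', hq, hF⟩ := h.exists_cokernel (SES.biprod P P') (a := i) (c := i')
      (b := biprod.lift e (g ≫ i'))
      (by ext <;> simp [he, reassoc_of% h.1]) (by simp) hi hi'
    exact ⟨_, F, _, q, hq, inferInstance, _, _, _, _, hF, hX', hZ'⟩

/-- If `X ⊕ X'` embeds into the projective `P`, then `P / X` is a retract of the pushout of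
`X ⊕ X' ⟶ P` along the projection to `X'`. -/
theorem of_retract {X Y : C} (hY : InTotallyAcyclicClass Y) {i : X ⟶ Y} {r : Y ⟶ X}
    (hir : i ≫ r = 𝟙 X) : InTotallyAcyclicClass X := by
  refine of_right.{_, _, w} (S := fun X => ∃ (Y : C) (i : X ⟶ Y) (r : Y ⟶ X), i ≫ r = 𝟙 X ∧
    InTotallyAcyclicClass Y) ?_ ?_ ⟨Y, i, r, hir, hY⟩
  · rintro X ⟨Y, i, r, hir, hY⟩ Q hQ n
    have := hY.subsingleton_ext.{_, _, w} hQ n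
    exact subsingleton_ext_of_retract hir _
  · rintro X ⟨Y, i, r, hir, hY⟩
    obtain ⟨P, Y', j, p, hj, hP, hY'⟩ := hY.right
    have := hj.mono
    have : Mono i := mono_of_mono_fac hir
    have hc := SES.of_cokernel (i ≫ j)
    have := hc.epi
    -- The idempotent `e` replaces the projection to the complement of X, so no splitting of Y is
    -- needed. The pushout along it is an extension of Y' by Y, hence in the class.
    let e : Y ⟶ Y := 𝟙 Y - r ≫ i
    have hp := IsPushout.of_hasPushout j e
    obtain ⟨g', hg', hE⟩ := hj.pushout hp
    obtain ⟨s, hs⟩ := hc.desc (pushout.inl j e) (by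
      have : i ≫ e = 0 := by simp [e, reassoc_of% hir]
      rw [Category.assoc, hp.w, reassoc_of% this, zero_comp])
    have w : j ≫ cokernel.π (i ≫ j) = e ≫ j ≫ cokernel.π (i ≫ j) := by
      have := hc.1
      rw [Category.assoc] at this
      simp [e, this]
    refine ⟨P, _, _, _, hc, hP, _, s, hp.desc _ _ w, ?_, extension.{_, _, w} hE hY hY'⟩
    rw [← cancel_epi (cokernel.π (i ≫ j)), reassoc_of% hs, hp.inl_desc, Category.comp_id]

theorem of_iso {X Y : C} (hY : InTotallyAcyclicClass Y) (e : X ≅ Y) : InTotallyAcyclicClass X :=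
  hY.of_retract.{_, _, w} e.hom_inv_id

end InTotallyAcyclicClass

end TotallyAcyclic

/-! ### Approximations by Gorenstein-projectives with kernel of finite projective dimension -/

section Approximation

variable {C : Type u} [Category.{v} C] [Abelian C]

/-- The objects with a finite projective resolution. -/
inductive HasFiniteProjectiveResolution : C → Prop
  | projective {P : C} (hP : Projective P) : HasFiniteProjectiveResolution P
  | cokernel {X P Y : C} {i : X ⟶ P} {p : P ⟶ Y} (h : SES i p) (hP : Projective P)
      (hX : HasFiniteProjectiveResolution X) : HasFiniteProjectiveResolution Y

/-- Each member of the class is a quotient of an injective object with kernel in the class. -/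
def IsInjectiveSyzygyClass (T : ObjectProperty C) : Prop :=
  ∀ {Y : C}, T Y → ∃ (I Y' : C) (i : Y' ⟶ I) (p : I ⟶ Y), SES i p ∧ Injective I ∧ T Y'

section

variable [HasExt.{w} C]

theorem InTotallyAcyclicClass.subsingleton_ext_of_hasFiniteProjectiveResolution {X H : C}
    (hX : InTotallyAcyclicClass X) (hH : HasFiniteProjectiveResolution H) (n : ℕ) :
    Subsingleton (Ext.{w} X H (n + 1)) := by
  induction hH generalizing n with
  | projective hP => exact hX.subsingleton_ext hP n
  | cokernel h hP _ ih =>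
    have := hX.subsingleton_ext.{_, _, w} hP n
    have := ih (n + 1)
    exact h.subsingleton_ext_to_right _

/-- Writing R as a quotient of an injective by R' embeds Extⁿ⁺¹(Y, R) into Extⁿ⁺²(Y, R'). One
projective step brings this back to Extⁿ⁺¹(X, R'), so the resolution shortens at constant degree;
hence the induction must generalize over R. -/
theorem HasFiniteProjectiveResolution.subsingleton_ext {T : ObjectProperty C}
    (hT : IsInjectiveSyzygyClass T) {H R : C} (hH : HasFiniteProjectiveResolution H) (hR : T R)
    (n : ℕ) : Subsingleton (Ext.{w} H R (n + 1)) := by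
  induction hH generalizing n R with
  | @projective P hP => exact Ext.subsingleton_of_projective P R n
  | @cokernel X P Y i p h hP _ ih =>
    obtain ⟨I, R', j, r, hj, hI, hR'⟩ := hT hR
    have := ih hR' n
    have := Ext.subsingleton_of_projective P R' (n + 1)
    have := h.subsingleton_ext_right (W := R') (n + 1)
    have := Ext.subsingleton_of_injective Y I n
    exact hj.subsingleton_ext_to_right _

end

/-- The objects that are quotients of a cocycle of a totally acyclic complex of projectives by an
object with a finite projective resolution. -/
def HasApproximation : ObjectProperty C := fun M =>
  ∃ (H G : C) (f : H ⟶ G) (g : G ⟶ M), SES f g ∧ HasFiniteProjectiveResolution H ∧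
    InTotallyAcyclicClass G

namespace HasApproximation

theorem of_inTotallyAcyclicClass {X : C} (hX : InTotallyAcyclicClass X) : HasApproximation X :=
  ⟨0, X, 0, 𝟙 X, SES.of_desc (by simp) fun _ k _ => ⟨k, by simp⟩,
    .projective ((isZero_zero C).projective), hX⟩

/-- Embed G into a projective P with cokernel G' in the class. The pushout P ⊔_G K is P/H, of finite
projective resolution, and is an extension of G' by K. Its pushout along K ⟶ G₀ is an extension of
G' by G₀, hence in the class, and maps onto M with kernel P/H. -/
theorem of_ses [EnoughProjectives C] {K G₀ M : C} {k : K ⟶ G₀} {q : G₀ ⟶ M} (h : SES k q)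
    (hG₀ : InTotallyAcyclicClass G₀) (hK : HasApproximation K) : HasApproximation M := by
  let := HasExt.standard C
  obtain ⟨H, G, f, g, hf, hH, hG⟩ := hK
  obtain ⟨P, G', i, p, hi, hP, hG'⟩ := hG.right
  have := hi.mono
  have hp := IsPushout.of_hasPushout i g
  have hp' := IsPushout.of_hasPushout k (pushout.inr i g)
  obtain ⟨g', -, h₁⟩ := hi.pushout hp
  obtain ⟨_, -, h₂⟩ := h.pushout hp'
  obtain ⟨_, -, h₃⟩ := h₁.pushout hp'.flip
  exact ⟨_, _, _, _, h₂, .cokernel (hf.comp_mono hp) hP hH,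
    InTotallyAcyclicClass.extension h₃ hG₀ hG'⟩

/-- A proper presentation of an object with an approximation stays exact under `Hom(-, R)`. -/
theorem exists_ext {K G₀ M : C} (hM : HasApproximation M) {k : K ⟶ G₀} {q : G₀ ⟶ M} (h : SES k q)
    (hG₀ : InTotallyAcyclicClass G₀)
    (hq : ∀ G : C, InTotallyAcyclicClass G → ∀ a : G ⟶ M, ∃ b, b ≫ q = a)
    {T : ObjectProperty C} (hT : IsInjectiveSyzygyClass T) {R : C} (hR : T R) (a : K ⟶ R) :
    ∃ b, k ≫ b = a := by
  let := HasExt.standard C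
  obtain ⟨H, G, i, p, hi, hH, hG⟩ := hM
  obtain ⟨I, R', j, r, hj, hI, hR'⟩ := hT hR
  have := hi.mono
  have := h.mono
  obtain ⟨u, hu⟩ := hq G hG p
  have := hG₀.subsingleton_ext_of_hasFiniteProjectiveResolution hH 0
  obtain ⟨v, hv⟩ := hi.exists_lift q
  obtain ⟨u', hu'⟩ := h.lift (i ≫ u) (by rw [Category.assoc, hu, hi.1])
  obtain ⟨v', hv'⟩ := hi.lift (k ≫ v) (by rw [Category.assoc, hv, h.1])
  -- `u` and `v` are comparison maps over M between the two presentations: `u` exists by properness,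
  -- `v` because Ext¹(G₀, H) = 0. On kernels, `s` is a homotopy from `v' ≫ u'` to the identity of K.
  obtain ⟨s, hs⟩ := h.lift (𝟙 _ - v ≫ u) (by simp [hu, hv])
  have := hH.subsingleton_ext hT hR' 0
  obtain ⟨t, ht⟩ := hj.exists_lift (u' ≫ a)
  have hks : k ≫ s = 𝟙 _ - v' ≫ u' := by
    rw [← cancel_mono k]
    simp [hs, hu', reassoc_of% hv']
  -- By the homotopy, a = v'u'a + ksa. The second term visibly extends along `k`; in the first, u'a
  -- factors as H ⟶ I ⟶ R, and H ⟶ I extends to G by injectivity.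
  refine ⟨v ≫ Injective.factorThru t i ≫ r + s ≫ a, ?_⟩
  rw [Preadditive.comp_add, ← reassoc_of% hv', ← Category.assoc k, hks]
  simp [reassoc_of% (Injective.comp_factorThru t i), ht]

end HasApproximation

/-- A proper resolution, given by its syzygies, whose syzygies are eventually direct summands stays
exact under `Hom(-, R)`. -/
theorem exists_ext_of_syzygies [EnoughProjectives C] {Z G : ℕ → C} {k : ∀ n, Z (n + 1) ⟶ G n}
    {q : ∀ n, G n ⟶ Z n} (h : ∀ n, SES (k n) (q n)) (hG : ∀ n, InTotallyAcyclicClass (G n))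
    (hq : ∀ n, ∀ X : C, InTotallyAcyclicClass X → ∀ a : X ⟶ Z n, ∃ b, b ≫ q n = a)
    {N : ℕ} (hN : ∀ n, N ≤ n → ∃ r, k n ≫ r = 𝟙 _)
    {T : ObjectProperty C} (hT : IsInjectiveSyzygyClass T) {R : C} (hR : T R) (n : ℕ)
    (a : Z (n + 1) ⟶ R) : ∃ b, k n ≫ b = a := by
  let := HasExt.standard C
  -- Downward induction on n, with m bounding the distance to the range where the sequences split;
  -- there Z n is a retract of G n.
  have hZ (m n : ℕ) (hm : N ≤ n + m) : HasApproximation (Z n) := by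
    induction m generalizing n with
    | zero =>
      obtain ⟨r, hr⟩ := hN n hm
      have := (h n).epi
      obtain ⟨s, hs⟩ := (h n).desc (𝟙 _ - r ≫ k n) (by simp [reassoc_of% hr])
      refine .of_inTotallyAcyclicClass ((hG n).of_retract (i := s) (r := q n) ?_)
      rw [← cancel_epi (q n), reassoc_of% hs]
      simp [(h n).1]
    | succ m ih => exact .of_ses (h n) (hG n) (ih (n + 1) (by lia))
  exact (hZ N n (by lia)).exists_ext (h n) (hG n) (hq n) hT hR a

end Approximation

/-! ### Syzygy sequences of acyclic complexes and exactness of Hom complexes -/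

section Cycles

variable {C : Type u} [Category.{v} C] [Abelian C] {ι : Type w} {c : ComplexShape ι}

theorem SES.of_lift {X Y Z : C} {f : X ⟶ Y} {g : Y ⟶ Z} [Mono f] [Epi g] (w : f ≫ g = 0)
    (h : ∀ (W : C) (k : W ⟶ Y), k ≫ g = 0 → ∃ l : W ⟶ X, l ≫ f = k) : SES f g :=
  ⟨w, { exact := (ShortComplex.mk f g w).exact_of_f_is_kernel
          (KernelFork.IsLimit.ofι' f w fun k hk => ⟨(h _ k hk).choose, (h _ k hk).choose_spec⟩) }⟩

theorem ses_cycles (K : HomologicalComplex C c) {i j : ι} (hij : c.Rel i j) (h : K.ExactAt j) :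
    SES (K.iCycles i) (K.toCycles i j) := by
  have : Epi (K.toCycles i j) := by
    have h' := (ShortComplex.exact_iff_epi_toCycles _).1
      ((K.exactAt_iff' i j _ (c.prev_eq' hij) rfl).1 h)
    rw [← K.toCycles_cyclesIsoSc'_hom i j _ (c.prev_eq' hij) rfl] at h'
    exact (epi_comp_iff_of_isIso _ _).1 h'
  have hi : K.iCycles i ≫ K.toCycles i j = 0 := by
    rw [← cancel_mono (K.iCycles j), Category.assoc, K.toCycles_i, K.iCycles_d, zero_comp]
  refine SES.of_lift hi fun W k hk => ⟨K.liftCycles k j (c.next_eq' hij) ?_, K.liftCycles_i _ _ _ _⟩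
  rw [← K.toCycles_i, ← Category.assoc, hk, zero_comp]

theorem ses_opcycles (K : HomologicalComplex C c) {i j : ι} (hij : c.Rel i j) (h : K.ExactAt i) :
    SES (K.fromOpcycles i j) (K.pOpcycles j) := by
  have : Mono (K.fromOpcycles i j) := by
    have h' := (ShortComplex.exact_iff_mono_fromOpcycles _).1
      ((K.exactAt_iff' _ i j rfl (c.next_eq' hij)).1 h)
    rw [← K.opcyclesIsoSc'_inv_fromOpcycles _ i j rfl (c.next_eq' hij)] at h'
    exact (mono_comp_iff_of_isIso _ _).1 h'
  have hi : K.fromOpcycles i j ≫ K.pOpcycles j = 0 := by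
    rw [← cancel_epi (K.pOpcycles i), ← Category.assoc, K.p_fromOpcycles, K.d_pOpcycles, comp_zero]
  refine SES.of_desc hi fun W k hk => ⟨K.descOpcycles k i (c.prev_eq' hij) ?_,
    K.p_descOpcycles _ _ _ _⟩
  rw [← K.p_fromOpcycles, Category.assoc, hk, comp_zero]

theorem acyclic_homTo {K : HomologicalComplex C c} {G : C}
    (h : ∀ i j k, c.prev j = i → c.next j = k → ∀ a : K.X j ⟶ G, K.d i j ≫ a = 0 →
      ∃ b : K.X k ⟶ G, K.d j k ≫ b = a) : (((homTo c).obj (op K)).obj G).Acyclic := by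
  intro j
  refine (HomologicalComplex.exactAt_iff' _ _ j _ (show c.symm.prev j = c.next j from rfl)
    (show c.symm.next j = c.prev j from rfl)).2 ?_
  rw [ShortComplex.ab_exact_iff]
  exact h _ j _ rfl rfl

theorem acyclic_homFrom {K : HomologicalComplex C c} {G : C}
    (h : ∀ i j k, c.prev j = i → c.next j = k → ∀ a : G ⟶ K.X j, a ≫ K.d j k = 0 →
      ∃ b : G ⟶ K.X i, b ≫ K.d i j = a) : (((homFrom c).obj (op G)).obj K).Acyclic := by
  intro j
  refine (HomologicalComplex.exactAt_iff' _ _ j _ rfl rfl).2 ?_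
  rw [ShortComplex.ab_exact_iff]
  exact h _ j _ rfl rfl

end Cycles

/-! ### Splicing short exact sequences into a complex indexed by ℤ -/

section Splicing

variable {C : Type u} [Category.{v} C] [Abelian C]

/-- The complex `K` is obtained by splicing the short exact sequences `0 ⟶ Zⁿ ⟶ Kⁿ ⟶ Zⁿ⁺¹ ⟶ 0`. -/
structure IsSpliced (K : CochainComplex C ℤ) (Z : ℤ → C) (f : ∀ n, Z n ⟶ K.X n)
    (g : ∀ n, K.X n ⟶ Z (n + 1)) : Prop where
  ses (n : ℤ) : SES (f n) (g n)
  d_eq (n : ℤ) : K.d n (n + 1) = g n ≫ f (n + 1)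

namespace IsSpliced

variable {K : CochainComplex C ℤ} {Z : ℤ → C} {f : ∀ n, Z n ⟶ K.X n}
  {g : ∀ n, K.X n ⟶ Z (n + 1)} (h : IsSpliced K Z f g)

include h

theorem acyclic : K.Acyclic := by
  intro n
  obtain ⟨m, rfl⟩ : ∃ m, n = m + 1 := ⟨n - 1, by lia⟩
  rw [K.exactAt_iff_exact_up_to_refinements m (m + 1) (m + 1 + 1) (by simp) (by simp)]
  have := (h.ses (m + 1 + 1)).mono
  have := (h.ses m).epi
  intro A x hx
  obtain ⟨z, rfl⟩ := (h.ses (m + 1)).lift x (by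
    rw [← cancel_mono (f (m + 1 + 1)), Category.assoc, ← h.d_eq, zero_comp, hx])
  obtain ⟨A', π, hπ, y, hy⟩ := surjective_up_to_refinements_of_epi (g m) z
  refine ⟨A', π, hπ, y, ?_⟩
  rw [h.d_eq, ← Category.assoc, hy, Category.assoc]

theorem nonempty_cycles_iso : Nonempty (K.cycles 0 ≅ Z 0) := by
  have := (h.ses 0).mono
  have := (h.ses (0 + 1)).mono
  have w : f 0 ≫ K.d 0 (0 + 1) = 0 := by rw [h.d_eq, ← Category.assoc, (h.ses 0).1, zero_comp]
  refine ⟨IsLimit.conePointUniqueUpToIso (K.cyclesIsKernel 0 (0 + 1) (by simp))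
    (KernelFork.IsLimit.ofι' (f 0) w fun k hk => ?_)⟩
  have := (h.ses 0).lift k (by
    rwa [h.d_eq, ← Category.assoc, ← zero_comp (f := f (0 + 1)), cancel_mono] at hk)
  exact ⟨this.choose, this.choose_spec⟩

theorem nonempty_image_iso : Nonempty (image (K.d (-1) 0) ≅ Z 0) := by
  let g' : K.X (-1) ⟶ Z 0 := g (-1)
  have hd : g' ≫ f 0 = K.d (-1) 0 := (h.d_eq (-1)).symm
  have : Epi g' := (h.ses (-1)).epi
  have := strongEpi_of_epi g'
  have := (h.ses 0).mono
  exact ⟨(image.isoStrongEpiMono g' (f 0) hd).symm⟩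

end IsSpliced

theorem exists_isSpliced {T Q₀ : ObjectProperty C}
    (right : ∀ {Y : C}, T Y → ∃ (P Y' : C) (i : Y ⟶ P) (p : P ⟶ Y'), SES i p ∧ Q₀ P ∧ T Y')
    (left : ∀ {Y : C}, T Y → ∃ (P Y' : C) (i : Y' ⟶ P) (p : P ⟶ Y), SES i p ∧ Q₀ P ∧ T Y')
    {X : C} (hX : T X) : ∃ (K : CochainComplex C ℤ) (Z : ℤ → C) (f : ∀ n, Z n ⟶ K.X n)
      (g : ∀ n, K.X n ⟶ Z (n + 1)), IsSpliced K Z f g ∧ (∀ n, Q₀ (K.X n)) ∧ (∀ n, T (Z n)) ∧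
        Z 0 = X := by
  have right' (Y : {Y : C // T Y}) : ∃ (P : C) (Y' : {Y : C // T Y}) (i : Y.1 ⟶ P) (p : P ⟶ Y'.1),
      SES i p ∧ Q₀ P := by
    obtain ⟨P, Y', i, p, h, hP, hY'⟩ := right Y.2
    exact ⟨P, ⟨Y', hY'⟩, i, p, h, hP⟩
  have left' (Y : {Y : C // T Y}) : ∃ (P : C) (Y' : {Y : C // T Y}) (i : Y'.1 ⟶ P) (p : P ⟶ Y.1),
      SES i p ∧ Q₀ P := by
    obtain ⟨P, Y', i, p, h, hP, hY'⟩ := left Y.2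
    exact ⟨P, ⟨Y', hY'⟩, i, p, h, hP⟩
  choose Pr r ir pr hr hPr using right'
  choose Pl l il pl hl hPl using left'
  let rs (n : ℕ) : {Y : C // T Y} := n.rec ⟨X, hX⟩ fun _ Y => r Y
  let ls (n : ℕ) : {Y : C // T Y} := n.rec ⟨X, hX⟩ fun _ Y => l Y
  let Z : ℤ → {Y : C // T Y} := fun n => match n with
    | .ofNat n => rs n
    | .negSucc n => ls (n + 1)
  let Q : ℤ → C := fun n => match n with
    | .ofNat n => Pr (rs n)
    | .negSucc n => Pl (ls n)
  let f (n : ℤ) : (Z n).1 ⟶ Q n := match n with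
    | .ofNat n => ir (rs n)
    | .negSucc n => il (ls n)
  -- Degree -1 is a separate case: its target sits in degree 0, where the two half-infinite
  -- sequences meet at X.
  let g (n : ℤ) : Q n ⟶ (Z (n + 1)).1 := match n with
    | .ofNat n => pr (rs n)
    | .negSucc 0 => pl (ls 0)
    | .negSucc (n + 1) => pl (ls (n + 1))
  have h (n : ℤ) : SES (f n) (g n) := match n with
    | .ofNat n => hr (rs n)
    | .negSucc 0 => hl (ls 0)
    | .negSucc (n + 1) => hl (ls (n + 1))
  refine ⟨CochainComplex.of Q (fun n => g n ≫ f (n + 1)) fun n => ?_, fun n => (Z n).1, f, g,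
    ⟨h, CochainComplex.of_d Q fun n => g n ≫ f (n + 1)⟩, fun n => ?_, fun n => (Z n).2, rfl⟩
  · rw [Category.assoc, ← Category.assoc (f (n + 1)), (h (n + 1)).1, zero_comp, comp_zero]
  · match n with
    | .ofNat n => exact hPr _
    | .negSucc n => exact hPl _

end Splicing

/-! ### Gorenstein-projective and Gorenstein-injective modules as members of totally acyclic classes
-/

section Characterization

variable {A : Type u} [Ring A]

theorem GorensteinProjective.inTotallyAcyclicClass {M : ModuleCat.{u} A}
    (hM : GorensteinProjective A M) : InTotallyAcyclicClass M := by
  obtain ⟨P, hP, hac, hQ, ⟨e⟩⟩ := hM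
  let := HasExt.standard (ModuleCat.{u} A)
  have hs (n : ℤ) := ses_cycles P (show (ComplexShape.up ℤ).Rel n (n + 1) by simp) (hac _)
  suffices InTotallyAcyclicClass (P.cycles 0) from this.of_iso e.symm
  refine ⟨fun Y => ∃ n, Y = P.cycles n, ⟨?_, ?_⟩, 0, rfl⟩
  · rintro _ ⟨n, rfl⟩
    exact ⟨_, _, _, _, hs n, hP n, _, rfl⟩
  · rintro _ ⟨n, rfl⟩
    -- The left sequence of the cocycles in degree m + 2 starts at those in degree m + 1; a map from
    -- the latter to Q is extended by exactness of Hom(P, Q) one degree earlier, at m.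
    obtain ⟨m, rfl⟩ : ∃ m, n = m + 1 + 1 := ⟨n - 2, by lia⟩
    refine ⟨_, _, _, _, hs (m + 1), hP _, ⟨_, rfl⟩, fun Q h a => ?_⟩
    obtain ⟨b, hb⟩ := exists_ext_of_acyclic (hQ Q h) (i := m - 1) (j := m) (k := m + 1) (by simp)
      (by simp) (P.toCycles m (m + 1) ≫ a) (by rw [P.d_toCycles_assoc, zero_comp])
    have := (hs m).epi
    exact ⟨b, by rw [← cancel_epi (P.toCycles m (m + 1)), P.toCycles_i_assoc, hb]⟩

theorem GorensteinInjective.inTotallyAcyclicClass {N : ModuleCat.{u} A}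
    (hN : GorensteinInjective A N) : InTotallyAcyclicClass (op N) := by
  obtain ⟨I, hI, hac, hJ, ⟨e⟩⟩ := hN
  let := HasExt.standard (ModuleCat.{u} A)ᵒᵖ
  have hs (n : ℤ) := ses_cycles I (show (ComplexShape.up ℤ).Rel n (n + 1) by simp) (hac _)
  have : Epi (I.toCycles (-1) 0) := (hs (-1)).epi
  have := strongEpi_of_epi (I.toCycles (-1) 0)
  let e' : I.cycles 0 ≅ image (I.d (-1) 0) :=
    image.isoStrongEpiMono (I.toCycles (-1) 0) (I.iCycles 0) (I.toCycles_i _ _)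
  suffices InTotallyAcyclicClass (op (I.cycles 0)) from this.of_iso (e' ≪≫ e).op
  refine ⟨fun Y => ∃ n, Y = op (I.cycles n), ⟨?_, ?_⟩, 0, rfl⟩
  · rintro _ ⟨n, rfl⟩
    obtain ⟨m, rfl⟩ : ∃ m, n = m + 1 := ⟨n - 1, by lia⟩
    have := hI m
    exact ⟨_, _, _, _, (hs m).op, inferInstance, _, rfl⟩
  · rintro _ ⟨n, rfl⟩
    have := hI n
    refine ⟨_, _, _, _, (hs n).op, inferInstance, ⟨_, rfl⟩, fun Q h a => ?_⟩
    obtain ⟨b, hb⟩ := exists_lift_of_acyclic (hJ Q.unop inferInstance) (i := n) (j := n + 1)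
      (k := n + 1 + 1) (by simp) (by simp) (a.unop ≫ I.iCycles (n + 1)) (by simp)
    refine ⟨b.op, Quiver.Hom.unop_inj ?_⟩
    rw [← cancel_mono (I.iCycles (n + 1)), ← hb]
    simp

theorem gorensteinProjective_iff {M : ModuleCat.{u} A} :
    GorensteinProjective A M ↔ InTotallyAcyclicClass M := by
  refine ⟨fun h => h.inTotallyAcyclicClass, fun h => ?_⟩
  let := HasExt.standard (ModuleCat.{u} A)
  obtain ⟨K, Z, f, g, hK, hP, hZ, rfl⟩ := exists_isSpliced (T := InTotallyAcyclicClass)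
    (Q₀ := isProjective _) (fun hY => hY.right) (fun hY => by
      obtain ⟨P, Y', i, p, h, hP, hY', -⟩ := hY.left
      exact ⟨P, Y', i, p, h, hP, hY'⟩) h
  refine ⟨K, hP, hK.acyclic, fun Q hQ => acyclic_homTo ?_, hK.nonempty_cycles_iso⟩
  rintro _ n _ rfl rfl a ha
  obtain ⟨m, rfl⟩ : ∃ m, n = m + 1 := ⟨n - 1, by lia⟩
  rw [CochainComplex.prev, add_sub_cancel_right, hK.d_eq, Category.assoc] at ha
  have := (hK.ses m).epi
  obtain ⟨l, rfl⟩ := (hK.ses (m + 1)).desc a (by rw [← cancel_epi (g m), ha, comp_zero])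
  -- A cocycle of Hom(K, Q) factors through Z in degree m + 2; the obstruction to extending it over
  -- the next term lies in Ext¹ of the following Z.
  have := (hZ (m + 1 + 1 + 1)).subsingleton_ext hQ 0
  obtain ⟨b, rfl⟩ := (hK.ses (m + 1 + 1)).exists_ext l
  rw [CochainComplex.next]
  exact ⟨b, by rw [hK.d_eq, Category.assoc]⟩

theorem gorensteinInjective_iff {N : ModuleCat.{u} A} :
    GorensteinInjective A N ↔ InTotallyAcyclicClass (op N) := by
  refine ⟨fun h => h.inTotallyAcyclicClass, fun h => ?_⟩
  let := HasExt.standard (ModuleCat.{u} A)ᵒᵖ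
  obtain ⟨K, Z, f, g, hK, hI, hZ, rfl⟩ := exists_isSpliced (T := fun Y => InTotallyAcyclicClass (op Y))
    (Q₀ := isInjective _) (fun hY => by
      obtain ⟨P, Y', i, p, h, hP, hY', -⟩ := hY.left
      exact ⟨P.unop, Y'.unop, _, _, h.unop, inferInstanceAs (Injective P.unop), hY'⟩)
    (fun hY => by
      obtain ⟨P, Y', i, p, h, hP, hY'⟩ := hY.right
      exact ⟨P.unop, Y'.unop, _, _, h.unop, inferInstanceAs (Injective P.unop), hY'⟩) h
  refine ⟨K, hI, hK.acyclic, fun J hJ => acyclic_homFrom ?_, hK.nonempty_image_iso⟩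
  rintro _ n _ rfl rfl a ha
  obtain ⟨m, rfl⟩ : ∃ m, n = m + 1 := ⟨n - 1, by lia⟩
  rw [CochainComplex.next, hK.d_eq, ← Category.assoc] at ha
  have := (hK.ses (m + 1 + 1)).mono
  obtain ⟨l, rfl⟩ := (hK.ses (m + 1)).lift a (by rw [← cancel_mono (f (m + 1 + 1)), ha, zero_comp])
  have := (hZ m).subsingleton_ext (Q := op J) inferInstance 0
  obtain ⟨b, hb⟩ := (hK.ses m).op.exists_ext l.op
  rw [CochainComplex.prev, add_sub_cancel_right]
  exact ⟨b.unop, by rw [hK.d_eq, ← Category.assoc]; exact congrArg (·.unop ≫ f (m + 1)) hb⟩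

theorem isInjectiveSyzygyClass_gorensteinInjective :
    IsInjectiveSyzygyClass (GorensteinInjective A) := by
  intro Y hY
  obtain ⟨P, Y', i, p, h, hP, hY'⟩ := hY.inTotallyAcyclicClass.right
  exact ⟨P.unop, Y'.unop, _, _, h.unop, inferInstance, gorensteinInjective_iff.2 hY'⟩

/-- An embedding into a projective with Gorenstein-projective cokernel becomes, in the opposite
category, a quotient of an injective. This is the input to the dual use of `exists_ext_of_syzygies`.
-/
theorem isInjectiveSyzygyClass_gorensteinProjective_unop :
    IsInjectiveSyzygyClass (GorensteinProjective A).op := by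
  intro Y hY
  obtain ⟨P, Y', i, p, h, hP, hY'⟩ := (GorensteinProjective.inTotallyAcyclicClass hY).right
  exact ⟨op P, op Y', _, _, h.op, inferInstance, gorensteinProjective_iff.2 hY'⟩

end Characterization

/-! ### Finite Gorenstein dimension makes proper resolutions exact for the other class -/

section FiniteDimension

variable {A : Type u} [Ring A]

/-- A proper Gorenstein-projective resolution whose differentials are eventually weak cokernels
stays exact under `Hom(-, R)` for Gorenstein-injective `R`. -/
theorem acyclic_homTo_of_gorensteinInjective {L : ChainComplex (ModuleCat.{u} A) ℕ}
    (hL : L.Acyclic) (hG : ∀ n, GorensteinProjective A (L.X (n + 1)))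
    (hp : ∀ G, GorensteinProjective A G → (((homFrom _).obj (op G)).obj L).Acyclic) {N : ℕ}
    (hN : ∀ n, N ≤ n → ∀ (W : ModuleCat.{u} A) (a : L.X (n + 2) ⟶ W),
      L.d (n + 3) (n + 2) ≫ a = 0 → ∃ b, L.d (n + 2) (n + 1) ≫ b = a)
    {R : ModuleCat.{u} A} (hR : GorensteinInjective A R) :
    (((homTo _).obj (op L)).obj R).Acyclic := by
  have hs (n : ℕ) := ses_cycles L (show (ComplexShape.down ℕ).Rel (n + 1) n by simp) (hL _)
  have hepi (n : ℕ) : Epi (L.toCycles (n + 1) n) := (hs n).epi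
  have hlift (n : ℕ) (X : ModuleCat.{u} A) (hX : InTotallyAcyclicClass X) (a : X ⟶ L.cycles n) :
      ∃ b, b ≫ L.toCycles (n + 1) n = a := by
    obtain ⟨b, hb⟩ := exists_lift_of_acyclic (hp X (gorensteinProjective_iff.2 hX))
      (i := n + 1) (j := n) (by simp) rfl (a ≫ L.iCycles n)
      (by rw [Category.assoc, L.iCycles_d, comp_zero])
    exact ⟨b, by rw [← cancel_mono (L.iCycles n), Category.assoc, L.toCycles_i, hb]⟩
  -- The map onto the cocycles kills the incoming differential, so the weak cokernel property
  -- factors it through the outgoing one; the factor is a retraction.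
  have hret (n : ℕ) (hn : N ≤ n) : ∃ r, L.iCycles (n + 1) ≫ r = 𝟙 _ := by
    obtain ⟨r, hr⟩ := hN n hn _ (L.toCycles (n + 2) (n + 1))
      (L.d_toCycles (n + 3) (n + 2) (n + 1))
    refine ⟨r, ?_⟩
    rw [← cancel_epi (L.toCycles (n + 2) (n + 1)), L.toCycles_i_assoc, Category.comp_id, hr]
  have hext := exists_ext_of_syzygies (Z := fun n => L.cycles n) (G := fun n => L.X (n + 1)) hs
    (fun n => gorensteinProjective_iff.1 (hG n)) hlift hret
    isInjectiveSyzygyClass_gorensteinInjective hR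
  refine acyclic_homTo ?_
  rintro _ (_ | n) _ rfl rfl a ha
  · rw [ChainComplex.prev, ← L.toCycles_i, Category.assoc,
      ← comp_zero (f := L.toCycles (0 + 1) 0), cancel_epi,
      Preadditive.IsIso.comp_left_eq_zero] at ha
    exact ⟨0, by rw [ha, comp_zero]⟩
  · rw [ChainComplex.prev, ← L.toCycles_i, Category.assoc, ← comp_zero (f := L.toCycles _ (n + 1)),
      cancel_epi] at ha
    obtain ⟨l, rfl⟩ := (hs n).desc a ha
    rw [ChainComplex.next_nat_succ]
    -- For n = 0 the cocycles are all of `L.X 0`, as no differential leaves degree 0.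
    have : ∃ b, L.iCycles n ≫ b = l := by
      cases n with
      | zero => exact ⟨inv (L.iCycles 0) ≫ l, by simp⟩
      | succ n => exact hext n l
    obtain ⟨b, rfl⟩ := this
    exact ⟨b, by rw [L.toCycles_i_assoc]⟩

/-- A proper Gorenstein-injective coresolution whose differentials are eventually weak kernels
stays exact under `Hom(G, -)` for Gorenstein-projective `G`. -/
theorem acyclic_homFrom_of_gorensteinProjective {L : CochainComplex (ModuleCat.{u} A) ℕ}
    (hL : L.Acyclic) (hI : ∀ n, GorensteinInjective A (L.X (n + 1)))
    (hp : ∀ R, GorensteinInjective A R → (((homTo _).obj (op L)).obj R).Acyclic) {N : ℕ}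
    (hN : ∀ n, N ≤ n → ∀ (W : ModuleCat.{u} A) (a : W ⟶ L.X (n + 2)),
      a ≫ L.d (n + 2) (n + 3) = 0 → ∃ b, b ≫ L.d (n + 1) (n + 2) = a)
    {G : ModuleCat.{u} A} (hG : GorensteinProjective A G) :
    (((homFrom _).obj (op G)).obj L).Acyclic := by
  have hs (n : ℕ) := ses_opcycles L (show (ComplexShape.up ℕ).Rel n (n + 1) by simp) (hL _)
  have hmono (n : ℕ) : Mono (L.fromOpcycles n (n + 1)) := (hs n).mono
  have hlift (n : ℕ) (X : (ModuleCat.{u} A)ᵒᵖ) (hX : InTotallyAcyclicClass X)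
      (a : X ⟶ op (L.opcycles n)) : ∃ b, b ≫ (L.fromOpcycles n (n + 1)).op = a := by
    obtain ⟨b, hb⟩ := exists_ext_of_acyclic (hp X.unop (gorensteinInjective_iff.2 hX))
      (j := n) (k := n + 1) rfl (by simp) (L.pOpcycles n ≫ a.unop)
      (by rw [L.d_pOpcycles_assoc, zero_comp])
    refine ⟨b.op, Quiver.Hom.unop_inj ?_⟩
    rw [← cancel_epi (L.pOpcycles n), ← hb, ← L.p_fromOpcycles, Category.assoc]
    rfl
  have hret (n : ℕ) (hn : N ≤ n) : ∃ r, (L.pOpcycles (n + 1)).op ≫ r = 𝟙 _ := by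
    obtain ⟨r, hr⟩ := hN n hn _ (L.fromOpcycles (n + 1) (n + 2))
      (L.fromOpcycles_d (n + 1) (n + 2) (n + 3))
    refine ⟨r.op, Quiver.Hom.unop_inj ?_⟩
    rw [← cancel_mono (L.fromOpcycles (n + 1) (n + 2))]
    change (r ≫ L.pOpcycles (n + 1)) ≫ _ = 𝟙 _ ≫ _
    rw [Category.assoc, L.p_fromOpcycles, Category.id_comp, hr]
  have hext := exists_ext_of_syzygies (Z := fun n => op (L.opcycles n))
    (G := fun n => op (L.X (n + 1))) (fun n => (hs n).op)
    (fun n => gorensteinInjective_iff.1 (hI n)) hlift hret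
    isInjectiveSyzygyClass_gorensteinProjective_unop (R := op G) hG
  refine acyclic_homFrom ?_
  rintro _ (_ | n) _ rfl rfl a ha
  · rw [CochainComplex.next, ← L.p_fromOpcycles, ← Category.assoc,
      ← zero_comp (f := L.fromOpcycles 0 (0 + 1)), cancel_mono,
      Preadditive.IsIso.comp_right_eq_zero] at ha
    exact ⟨0, by rw [ha, zero_comp]⟩
  · rw [CochainComplex.next, ← L.p_fromOpcycles, ← Category.assoc,
      ← zero_comp (f := L.fromOpcycles (n + 1) _), cancel_mono] at ha
    obtain ⟨l, rfl⟩ := (hs n).lift a ha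
    rw [CochainComplex.prev_nat_succ]
    have : ∃ b, b ≫ L.pOpcycles n = l := by
      cases n with
      | zero => exact ⟨l ≫ inv (L.pOpcycles 0), by simp⟩
      | succ n =>
        obtain ⟨b, hb⟩ := hext n l.op
        exact ⟨b.unop, congrArg Quiver.Hom.unop hb⟩
    obtain ⟨b, rfl⟩ := this
    exact ⟨b, by rw [Category.assoc, L.p_fromOpcycles]⟩

theorem exists_le_of_gpDim_lt_top {M : (GPResolvable A).FullSubcategory} (h : gpDim M < ⊤) :
    ∃ N : ℕ, ∀ n, N ≤ n → ∀ W, IsZero (((extGP A n).obj (op M)).obj W) := by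
  obtain ⟨k, hk⟩ := ENat.ne_top_iff_exists.1 h.ne
  refine ⟨k + 1, fun n hn W => ?_⟩
  by_contra hW
  have : (n : ℕ∞) ≤ gpDim M := le_iSup₂_of_le n ⟨W, hW⟩ le_rfl
  rw [← hk, Nat.cast_le] at this
  lia

theorem exists_le_of_giDim_lt_top {N : (GIResolvable A).FullSubcategory} (h : giDim N < ⊤) :
    ∃ k : ℕ, ∀ n, k ≤ n → ∀ W, IsZero (((extGI A n).obj W).obj N) := by
  obtain ⟨k, hk⟩ := ENat.ne_top_iff_exists.1 h.ne
  refine ⟨k + 1, fun n hn W => ?_⟩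
  by_contra hW
  have : (n : ℕ∞) ≤ giDim N := le_iSup₂_of_le n ⟨W, hW⟩ le_rfl
  rw [← hk, Nat.cast_le] at this
  lia

theorem acyclic_homTo_properResolution {M : (GPResolvable A).FullSubcategory} (h : gpDim M < ⊤)
    {R : ModuleCat.{u} A} (hR : GorensteinInjective A R) :
    (((homTo _).obj (op ((properResolution _ M).complex.augment _
      (properResolution _ M).d_π))).obj R).Acyclic := by
  obtain ⟨N, hN⟩ := exists_le_of_gpDim_lt_top h
  let P := properResolution _ M
  refine acyclic_homTo_of_gorensteinInjective P.acyclic P.mem P.proper (N := N)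
    (fun n hn W a ha => ?_) hR
  -- Augmenting shifts degrees by one: the differentials n + 3 → n + 2 → n + 1 of the augmented
  -- complex are n + 2 → n + 1 → n of the resolution, so the weak cokernel property is Ext_GP(M, W)
  -- = 0 in degree n + 1.
  have h' := (HomologicalComplex.exactAt_iff' _ n (n + 1) (n + 2)
    (show (ComplexShape.down ℕ).symm.prev (n + 1) = n from ChainComplex.next_nat_succ n)
    (show (ComplexShape.down ℕ).symm.next (n + 1) = n + 2 from ChainComplex.prev ℕ _)).1
    ((HomologicalComplex.exactAt_iff_isZero_homology _ _).2 (hN (n + 1) (by lia) W))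
  rw [ShortComplex.ab_exact_iff] at h'
  exact h' a ha

theorem acyclic_homFrom_properCoresolution {N : (GIResolvable A).FullSubcategory}
    (h : giDim N < ⊤) {G : ModuleCat.{u} A} (hG : GorensteinProjective A G) :
    (((homFrom _).obj (op G)).obj ((properCoresolution _ N).complex.augment _
      (properCoresolution _ N).η_d)).Acyclic := by
  obtain ⟨k, hk⟩ := exists_le_of_giDim_lt_top h
  let P := properCoresolution _ N
  refine acyclic_homFrom_of_gorensteinProjective P.acyclic P.mem P.proper (N := k)
    (fun n hn W a ha => ?_) hG
  have h' := (HomologicalComplex.exactAt_iff' _ n (n + 1) (n + 2)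
    (show (ComplexShape.up ℕ).prev (n + 1) = n by simp)
    (show (ComplexShape.up ℕ).next (n + 1) = n + 2 by simp)).1
    ((HomologicalComplex.exactAt_iff_isZero_homology _ _).2 (hk (n + 1) (by lia) (op W)))
  rw [ShortComplex.ab_exact_iff] at h'
  exact h' a ha

end FiniteDimension

/-! ### Staircases in an exact first quadrant double complex -/

section Balancing

/-- A first quadrant double complex of abelian groups with exact rows and columns, augmented by the
complex `B` of kernels of the vertical and the complex `C` of kernels of the horizontal
differentials at the boundary. -/
structure ExactBicomplex where
  /-- the objects of the double complex -/
  A : ℕ → ℕ → Type u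
  /-- the augmentation of the columns -/
  B : ℕ → Type u
  /-- the augmentation of the rows -/
  C : ℕ → Type u
  [instA : ∀ p q, AddCommGroup (A p q)]
  [instB : ∀ p, AddCommGroup (B p)]
  [instC : ∀ q, AddCommGroup (C q)]
  /-- the horizontal differential -/
  dh {p q : ℕ} : A p q →+ A (p + 1) q
  /-- the vertical differential -/
  dv {p q : ℕ} : A p q →+ A p (q + 1)
  /-- the differential of `B` -/
  dB {p : ℕ} : B p →+ B (p + 1)
  /-- the differential of `C` -/
  dC {q : ℕ} : C q →+ C (q + 1)
  /-- the inclusion of `B` -/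
  ε {p : ℕ} : B p →+ A p 0
  /-- the inclusion of `C` -/
  η {q : ℕ} : C q →+ A 0 q
  comm {p q : ℕ} (x : A p q) : dh (dv x) = dv (dh x)
  ε_dB {p : ℕ} (b : B p) : ε (dB b) = dh (ε b)
  η_dC {q : ℕ} (c : C q) : η (dC c) = dv (η c)
  ε_injective {p : ℕ} : Function.Injective (ε (p := p))
  η_injective {q : ℕ} : Function.Injective (η (q := q))
  exact_ε {p : ℕ} (x : A p 0) : dv x = 0 ↔ ∃ b, ε b = x
  exact_η {q : ℕ} (x : A 0 q) : dh x = 0 ↔ ∃ c, η c = x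
  exact_dv {p q : ℕ} (x : A p (q + 1)) : dv x = 0 ↔ ∃ y, dv y = x
  exact_dh {p q : ℕ} (x : A (p + 1) q) : dh x = 0 ↔ ∃ y, dh y = x

namespace ExactBicomplex

attribute [instance] instA instB instC

/-- Interchanging rows and columns. -/
abbrev transpose (D : ExactBicomplex.{u}) : ExactBicomplex.{u} where
  A p q := D.A q p
  B := D.C
  C := D.B
  dh := D.dv
  dv := D.dh
  dB := D.dC
  dC := D.dB
  ε := D.η
  η := D.ε
  comm x := (D.comm x).symm
  ε_dB := D.η_dC
  η_dC := D.ε_dB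
  ε_injective := @D.η_injective
  η_injective := @D.ε_injective
  exact_ε := D.exact_η
  exact_η := D.exact_ε
  exact_dv := D.exact_dh
  exact_dh := D.exact_dv

variable (D : ExactBicomplex.{u})

/-- The elements `b` and `c` are joined by a staircase in the double complex. -/
def Linked {n : ℕ} (b : D.B n) (c : D.C n) : Prop :=
  ∃ s t : ∀ p q, D.A p q, t n 0 = D.ε b ∧ t 0 n = D.η c ∧
    ∀ p q, p + q + 1 = n → D.dh (s p q) = t (p + 1) q ∧ D.dv (s p q) = t p (q + 1)

variable {D} {n : ℕ}

/-- The squares commute and `t` equals both images of `s`, so no signs occur and the relation is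
symmetric. Each statement from B to C thereby yields its converse. -/
theorem Linked.transpose {b : D.B n} {c : D.C n} (h : D.Linked b c) :
    D.transpose.Linked (n := n) c b := by
  obtain ⟨s, t, hb, hc, hst⟩ := h
  exact ⟨fun p q => s q p, fun p q => t q p, hc, hb, fun p q hpq => (hst q p (by lia)).symm⟩

theorem Linked.sub {b b' : D.B n} {c c' : D.C n} (h : D.Linked b c) (h' : D.Linked b' c') :
    D.Linked (b - b') (c - c') := by
  obtain ⟨s, t, hb, hc, hst⟩ := h
  obtain ⟨s', t', hb', hc', hst'⟩ := h'
  exact ⟨s - s', t - t', by simp [hb, hb'], by simp [hc, hc'], fun p q hpq => by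
    simp [(hst p q hpq).1, (hst p q hpq).2, (hst' p q hpq).1, (hst' p q hpq).2]⟩

/-- Walk along the antidiagonal: lift along `dh`, then apply `dv`. Each new element is killed by
both differentials, so the walk continues down to column 0, where exactness gives `c`. -/
theorem exists_linked (b : D.B n) (hb : D.dB b = 0) : ∃ c, D.dC c = 0 ∧ D.Linked b c := by
  have hσ (p q : ℕ) (x : D.A (p + 1) q) : ∃ y, D.dh x = 0 → D.dh y = x := by
    by_cases hx : D.dh x = 0
    · obtain ⟨y, hy⟩ := (D.exact_dh x).1 hx
      exact ⟨y, fun _ => hy⟩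
    · exact ⟨0, fun h => absurd h hx⟩
  choose σ hσ using hσ
  -- `t` is defined on the whole quadrant to avoid dependent indices; row 0 is ε b in column n and
  -- zero elsewhere, and only p + q = n matters.
  let t (q : ℕ) : ∀ p, D.A p q :=
    q.rec (fun p => D.ε (Function.update (fun p => (0 : D.B p)) n b p))
      fun q t p => D.dv (σ p q (t (p + 1)))
  have ht0 : t 0 n = D.ε b := congrArg D.ε (Function.update_self ..)
  have ht (q p : ℕ) (h : p + q = n) : D.dh (t q p) = 0 ∧ D.dv (t q p) = 0 := by
    induction q generalizing p with
    | zero =>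
      obtain rfl : p = n := h
      rw [ht0]
      exact ⟨by rw [← D.ε_dB, hb, map_zero], (D.exact_ε _).2 ⟨b, rfl⟩⟩
    | succ q ih =>
      obtain ⟨h₁, h₂⟩ := ih (p + 1) (by lia)
      refine ⟨?_, (D.exact_dv _).2 ⟨_, rfl⟩⟩
      change D.dh (D.dv (σ p q (t q (p + 1)))) = 0
      rw [D.comm, hσ p q _ h₁, h₂]
  obtain ⟨h₁, h₂⟩ := ht n 0 (by lia)
  obtain ⟨c, hc⟩ := (D.exact_η _).1 h₁
  refine ⟨c, D.η_injective ?_, fun p q => σ p q (t q (p + 1)), fun p q => t q p, ht0, hc.symm,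
    fun p q hpq => ⟨hσ p q _ (ht q (p + 1) (by lia)).1, rfl⟩⟩
  rw [D.η_dC, hc, h₂, map_zero]

theorem Linked.eq_zero {b : D.B 0} {c : D.C 0} (h : D.Linked b c) (hb : b = 0) : c = 0 := by
  obtain ⟨s, t, h₁, h₂, -⟩ := h
  exact D.η_injective (by rw [← h₂, h₁, hb, map_zero, map_zero])

theorem Linked.exists_eq {b : D.B (n + 1)} {c : D.C (n + 1)} (h : D.Linked b c)
    (hb : ∃ b₀, D.dB b₀ = b) : ∃ c₀, D.dC c₀ = c := by
  obtain ⟨s, t, h₁, h₂, hst⟩ := h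
  obtain ⟨b₀, rfl⟩ := hb
  -- `w` corrects `s` on the antidiagonal by elements with the same `dh` but zero `dv`, starting
  -- from ε b₀. In column 0 the difference s - w then comes from some c₀ with coboundary c.
  have key (q p : ℕ) (hpq : p + q = n) :
      ∃ w : D.A p q, D.dh w = D.dh (s p q) ∧ D.dv w = 0 := by
    induction q generalizing p with
    | zero =>
      obtain rfl : p = n := hpq
      exact ⟨D.ε b₀, by rw [(hst p 0 rfl).1, h₁, D.ε_dB], (D.exact_ε _).2 ⟨_, rfl⟩⟩
    | succ q ih =>
      obtain ⟨w, hw, hw'⟩ := ih (p + 1) (by lia)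
      obtain ⟨y, hy⟩ := (D.exact_dh (s (p + 1) q - w)).1 (by rw [map_sub, hw, sub_self])
      refine ⟨D.dv y, ?_, (D.exact_dv _).2 ⟨_, rfl⟩⟩
      rw [D.comm, hy, map_sub, hw', sub_zero, (hst (p + 1) q (by lia)).2,
        (hst p (q + 1) (by lia)).1]
  obtain ⟨w, hw, hw'⟩ := key n 0 (by lia)
  obtain ⟨c₀, hc₀⟩ := (D.exact_η (s 0 n - w)).1 (by rw [map_sub, hw, sub_self])
  refine ⟨c₀, D.η_injective ?_⟩
  rw [D.η_dC, hc₀, map_sub, hw', sub_zero, (hst 0 n (by lia)).2, h₂]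

end ExactBicomplex

/-- An additive relation between two groups of cocycles that matches cocycles and boundaries
induces an isomorphism of the quotients. -/
theorem exists_addEquiv_of_relation {Z₁ Z₂ H₁ H₂ : Type*} [AddCommGroup Z₁] [AddCommGroup Z₂]
    [AddCommGroup H₁] [AddCommGroup H₂] (π₁ : Z₁ →+ H₁) (π₂ : Z₂ →+ H₂)
    (h₁ : Function.Surjective π₁) (h₂ : Function.Surjective π₂) (r : Z₁ → Z₂ → Prop)
    (hsub : ∀ {z z' w w'}, r z w → r z' w' → r (z - z') (w - w'))
    (hl : ∀ z, ∃ w, r z w) (hr : ∀ w, ∃ z, r z w) (hz : ∀ {z w}, r z w → (π₁ z = 0 ↔ π₂ w = 0)) :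
    ∃ e : H₁ ≃+ H₂, ∀ z w, r z w → e (π₁ z) = π₂ w := by
  have heq {z z' w w'} (h : r z w) (h' : r z' w') : π₁ z = π₁ z' ↔ π₂ w = π₂ w' := by
    rw [← sub_eq_zero, ← map_sub, hz (hsub h h'), map_sub, sub_eq_zero]
  have hadd {z z' w w'} (h : r z w) (h' : r z' w') : r (z + z') (w + w') := by
    have := hsub h (hsub (hsub h' h') h')
    simpa using this
  choose f hf using h₁
  choose g hg using hl
  have hspec (z w) (h : r z w) : π₂ (g (f (π₁ z))) = π₂ w := (heq (hg _) h).1 (hf _)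
  let φ : H₁ →+ H₂ := AddMonoidHom.mk' (fun x => π₂ (g (f x))) fun x y => by
    rw [← map_add, ← heq (hg _) (hadd (hg _) (hg _)), map_add, hf, hf, hf]
  refine ⟨AddEquiv.ofBijective φ ⟨fun x y hxy => ?_, fun y => ?_⟩, hspec⟩
  · rw [← hf x, ← hf y]
    exact (heq (hg _) (hg _)).2 hxy
  · obtain ⟨w, rfl⟩ := h₂ y
    obtain ⟨z, hzw⟩ := hr w
    exact ⟨π₁ z, hspec z w hzw⟩

end Balancing

/-! ### Isomorphisms of homology induced by relations between cocycles -/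

section HomologyRelation

variable {ι ι' : Type*} {c : ComplexShape ι} {c' : ComplexShape ι'}
  {K K' : HomologicalComplex AddCommGrpCat.{v} c} {L L' : HomologicalComplex AddCommGrpCat.{v} c'}
  {n : ι} {m : ι'}

theorem iCycles_mem_ker (z : K.cycles n) (k : ι) : K.d n k (K.iCycles n z) = 0 :=
  ConcreteCategory.congr_hom (K.iCycles_d n k) z

theorem exists_iCycles_eq (x : K.X n) (hx : K.d n (c.next n) x = 0) : ∃ z, K.iCycles n z = x := by
  have h := ShortComplex.exact_of_f_is_kernel (ShortComplex.mk _ _ (K.iCycles_d n (c.next n)))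
    (K.cyclesIsKernel n _ rfl)
  rw [ShortComplex.ab_exact_iff] at h
  exact h x hx

theorem homologyπ_surjective : Function.Surjective (K.homologyπ n) :=
  (AddCommGrpCat.epi_iff_surjective _).1 inferInstance

theorem homologyπ_eq_zero_iff (z : K.cycles n) :
    K.homologyπ n z = 0 ↔ ∃ y, K.d (c.prev n) n y = K.iCycles n z := by
  have hi := (AddCommGrpCat.mono_iff_injective (K.iCycles n)).1 inferInstance
  have hd (y) : K.iCycles n (K.toCycles (c.prev n) n y) = K.d (c.prev n) n y :=
    ConcreteCategory.congr_hom (K.toCycles_i _ _) y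
  constructor
  · intro hz
    have h := ShortComplex.exact_of_g_is_cokernel
      (ShortComplex.mk _ _ (K.toCycles_comp_homologyπ (c.prev n) n)) (K.homologyIsCokernel _ n rfl)
    rw [ShortComplex.ab_exact_iff] at h
    obtain ⟨y, rfl⟩ := h z hz
    exact ⟨y, (hd y).symm⟩
  · rintro ⟨y, hy⟩
    rw [← hd] at hy
    rw [← hi hy]
    exact ConcreteCategory.congr_hom (K.toCycles_comp_homologyπ _ n) y

/-- The isomorphism `e` sends the class of a cocycle to the class of any cocycle related to it. -/
def InducedBy (e : K.homology n ≅ L.homology m) (r : K.X n → L.X m → Prop) : Prop :=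
  ∀ z w, r (K.iCycles n z) (L.iCycles m w) → e.hom (K.homologyπ n z) = L.homologyπ m w

theorem exists_inducedBy {r : K.X n → L.X m → Prop}
    (hsub : ∀ {x x' y y'}, r x y → r x' y' → r (x - x') (y - y'))
    (hl : ∀ x, K.d n (c.next n) x = 0 → ∃ y, L.d m (c'.next m) y = 0 ∧ r x y)
    (hr : ∀ y, L.d m (c'.next m) y = 0 → ∃ x, K.d n (c.next n) x = 0 ∧ r x y)
    (hz : ∀ {x y}, r x y →
      ((∃ x₀, K.d (c.prev n) n x₀ = x) ↔ ∃ y₀, L.d (c'.prev m) m y₀ = y)) :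
    ∃ e : K.homology n ≅ L.homology m, InducedBy e r := by
  obtain ⟨e, he⟩ := exists_addEquiv_of_relation (K.homologyπ n).hom (L.homologyπ m).hom
    homologyπ_surjective homologyπ_surjective
    (fun z w => r (K.iCycles n z) (L.iCycles m w))
    (fun {z z' w w'} h h' => by rw [map_sub, map_sub]; exact hsub h h')
    (fun z => by
      obtain ⟨y, hy, h⟩ := hl _ (iCycles_mem_ker z _)
      obtain ⟨w, rfl⟩ := exists_iCycles_eq y hy
      exact ⟨w, h⟩)
    (fun w => by
      obtain ⟨x, hx, h⟩ := hr _ (iCycles_mem_ker w _)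
      obtain ⟨z, rfl⟩ := exists_iCycles_eq x hx
      exact ⟨z, h⟩)
    (fun {z w} h => (homologyπ_eq_zero_iff z).trans ((hz h).trans (homologyπ_eq_zero_iff w).symm))
  exact ⟨e.toAddCommGrpIso, he⟩

/-- Every cocycle has a related cocycle, so the relation determines the isomorphism, and chain maps
respecting the relations must commute with it. -/
theorem InducedBy.naturality {r : K.X n → L.X m → Prop} {r' : K'.X n → L'.X m → Prop}
    {e : K.homology n ≅ L.homology m} {e' : K'.homology n ≅ L'.homology m}
    (he : InducedBy e r) (he' : InducedBy e' r')
    (hl : ∀ x, K.d n (c.next n) x = 0 → ∃ y, L.d m (c'.next m) y = 0 ∧ r x y)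
    (φ : K ⟶ K') (ψ : L ⟶ L') (h : ∀ x y, r x y → r' (φ.f n x) (ψ.f m y)) :
    HomologicalComplex.homologyMap φ n ≫ e'.hom = e.hom ≫ HomologicalComplex.homologyMap ψ m := by
  ext x
  obtain ⟨z, rfl⟩ := homologyπ_surjective x
  obtain ⟨y, hy, hzy⟩ := hl _ (iCycles_mem_ker z _)
  obtain ⟨w, rfl⟩ := exists_iCycles_eq y hy
  have h₁ : HomologicalComplex.homologyMap φ n (K.homologyπ n z) =
      K'.homologyπ n (HomologicalComplex.cyclesMap φ n z) :=
    ConcreteCategory.congr_hom (HomologicalComplex.homologyπ_naturality φ n) z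
  have h₂ : HomologicalComplex.homologyMap ψ m (L.homologyπ m w) =
      L'.homologyπ m (HomologicalComplex.cyclesMap ψ m w) :=
    ConcreteCategory.congr_hom (HomologicalComplex.homologyπ_naturality ψ m) w
  have h₃ : K'.iCycles n (HomologicalComplex.cyclesMap φ n z) = φ.f n (K.iCycles n z) :=
    ConcreteCategory.congr_hom (HomologicalComplex.cyclesMap_i φ n) z
  have h₄ : L'.iCycles m (HomologicalComplex.cyclesMap ψ m w) = ψ.f m (L.iCycles m w) :=
    ConcreteCategory.congr_hom (HomologicalComplex.cyclesMap_i ψ m) w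
  change e'.hom (HomologicalComplex.homologyMap φ n (K.homologyπ n z)) =
    HomologicalComplex.homologyMap ψ m (e.hom (K.homologyπ n z))
  rw [he z w hzy, h₁, h₂]
  exact he' _ _ (by rw [h₃, h₄]; exact h _ _ hzy)

end HomologyRelation

/-! ### The double complex Hom(Gₚ, Rq) and relative balance -/

section RelativeBalance

variable {C : Type u} [Category.{v} C] [Abelian C] {X Y : ObjectProperty C} {M M' N N' : C}

/-- The double complex `Hom(Gₚ, Rq)` of a proper resolution `G` of `M` and a proper coresolution
`R` of `N`, each acyclic relative to the terms of the other. -/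
def homBicomplex (P : ProperResolution X M) (Q : ProperCoresolution Y N)
    (hP : ∀ q, (((homTo _).obj (op (P.complex.augment P.π P.d_π))).obj (Q.complex.X q)).Acyclic)
    (hQ : ∀ p, (((homFrom _).obj (op (P.complex.X p))).obj
      (Q.complex.augment Q.η Q.η_d)).Acyclic) : ExactBicomplex.{v} where
  A p q := P.complex.X p ⟶ Q.complex.X q
  B p := P.complex.X p ⟶ N
  C q := M ⟶ Q.complex.X q
  dh {p q} := Preadditive.leftComp _ (P.complex.d (p + 1) p)
  dv {p q} := Preadditive.rightComp _ (Q.complex.d q (q + 1))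
  dB {p} := Preadditive.leftComp _ (P.complex.d (p + 1) p)
  dC {q} := Preadditive.rightComp _ (Q.complex.d q (q + 1))
  ε {p} := Preadditive.rightComp _ Q.η
  η {q} := Preadditive.leftComp _ P.π
  comm x := (Category.assoc _ _ _).symm
  ε_dB b := Category.assoc _ _ _
  η_dC c := (Category.assoc _ _ _).symm
  ε_injective {p} := by
    refine (injective_iff_map_eq_zero _).2 fun a ha => ?_
    -- At the left end `prev 0` is 0 by default and the differential 0 → 0 is zero, so exactness
    -- there is injectivity.
    obtain ⟨b, hb⟩ := exists_lift_of_acyclic (hQ p) (i := 0) (j := 0) (k := 1) (by simp) (by simp)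
      a ha
    rw [← hb, (Q.complex.augment Q.η Q.η_d).shape 0 0 (by simp), comp_zero]
    rfl
  η_injective {q} := by
    refine (injective_iff_map_eq_zero _).2 fun a ha => ?_
    obtain ⟨b, hb⟩ := exists_ext_of_acyclic (hP q) (i := 1) (j := 0) (k := 0) (by simp) (by simp)
      a ha
    rw [← hb, (P.complex.augment P.π P.d_π).shape 0 0 (by simp), zero_comp]
    rfl
  exact_ε {p} x := by
    refine ⟨fun hx => exists_lift_of_acyclic (hQ p) (i := 0) (j := 1) (k := 2) (by simp) (by simp)
      x hx, ?_⟩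
    rintro ⟨b, rfl⟩
    change (b ≫ Q.η) ≫ Q.complex.d 0 1 = 0
    rw [Category.assoc, Q.η_d, comp_zero]
  exact_η {q} x := by
    refine ⟨fun hx => exists_ext_of_acyclic (hP q) (i := 2) (j := 1) (k := 0) (by simp) (by simp)
      x hx, ?_⟩
    rintro ⟨b, rfl⟩
    change P.complex.d 1 0 ≫ P.π ≫ b = 0
    rw [← Category.assoc, P.d_π, zero_comp]
  exact_dv {p q} x := by
    refine ⟨fun hx => exists_lift_of_acyclic (hQ p) (i := q + 1) (j := q + 2) (k := q + 3)
      (by simp) (by simp) x hx, ?_⟩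
    rintro ⟨b, rfl⟩
    change (b ≫ _) ≫ _ = 0
    simp
  exact_dh {p q} x := by
    refine ⟨fun hx => exists_ext_of_acyclic (hP q) (i := p + 3) (j := p + 2) (k := p + 1)
      (by simp) (by simp) x hx, ?_⟩
    rintro ⟨b, rfl⟩
    change _ ≫ _ ≫ b = 0
    simp

variable (P : ProperResolution X M) (Q : ProperCoresolution Y N)
  (hP : ∀ q, (((homTo _).obj (op (P.complex.augment P.π P.d_π))).obj (Q.complex.X q)).Acyclic)
  (hQ : ∀ p, (((homFrom _).obj (op (P.complex.X p))).obj (Q.complex.augment Q.η Q.η_d)).Acyclic)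

/-- The relation between morphisms `Gₙ ⟶ N` and `M ⟶ Rⁿ` given by staircases in the double complex
`Hom(Gₚ, Rq)`. -/
def StaircaseRel (n : ℕ) : (P.complex.X n ⟶ N) → (M ⟶ Q.complex.X n) → Prop := fun b c =>
  ∃ s t : ∀ p q, P.complex.X p ⟶ Q.complex.X q, t n 0 = b ≫ Q.η ∧ t 0 n = P.π ≫ c ∧
    ∀ p q, p + q + 1 = n →
      P.complex.d (p + 1) p ≫ s p q = t (p + 1) q ∧ s p q ≫ Q.complex.d q (q + 1) = t p (q + 1)

/-- Composing every entry of the staircase with φ on one side and ψ on the other preserves all its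
equations. -/
theorem StaircaseRel.map {P : ProperResolution X M} {Q : ProperCoresolution Y N}
    {P' : ProperResolution X M'} {Q' : ProperCoresolution Y N'} {n : ℕ}
    {b : P.complex.X n ⟶ N} {c : M ⟶ Q.complex.X n} (h : StaircaseRel P Q n b c) {f : M' ⟶ M}
    {g : N ⟶ N'} (φ : P'.complex ⟶ P.complex) (ψ : Q.complex ⟶ Q'.complex)
    (hφ : φ.f 0 ≫ P.π = P'.π ≫ f) (hψ : Q.η ≫ ψ.f 0 = g ≫ Q'.η) :
    StaircaseRel P' Q' n (φ.f n ≫ b ≫ g) (f ≫ c ≫ ψ.f n) := by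
  obtain ⟨s, t, hb, hc, hst⟩ := h
  refine ⟨fun p q => φ.f p ≫ s p q ≫ ψ.f q, fun p q => φ.f p ≫ t p q ≫ ψ.f q, ?_, ?_,
    fun p q hpq => ⟨?_, ?_⟩⟩
  · simp [hb, hψ]
  · simp [hc, reassoc_of% hφ]
  · dsimp only
    rw [← (hst p q hpq).1, ← φ.comm_assoc, Category.assoc]
  · simp [← (hst p q hpq).2]

include hP hQ

theorem exists_staircaseRel {n : ℕ} (b : P.complex.X n ⟶ N) {k : ℕ}
    (hk : (ComplexShape.down ℕ).prev n = k) (hb : P.complex.d k n ≫ b = 0) :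
    ∃ c : M ⟶ Q.complex.X n, c ≫ Q.complex.d n ((ComplexShape.up ℕ).next n) = 0 ∧
      StaircaseRel P Q n b c := by
  rw [ChainComplex.prev] at hk
  subst hk
  rw [CochainComplex.next]
  exact ExactBicomplex.exists_linked (D := homBicomplex P Q hP hQ) b hb

theorem exists_inducedBy_staircaseRel (n : ℕ) :
    ∃ e : (((homTo _).obj (op P.complex)).obj N).homology n ≅
      (((homFrom _).obj (op M)).obj Q.complex).homology n,
      InducedBy e (StaircaseRel P Q n) := by
  let D := homBicomplex P Q hP hQ
  refine exists_inducedBy ?_ ?_ ?_ ?_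
  · exact fun h h' => ExactBicomplex.Linked.sub (D := D) h h'
  · exact fun b hb => exists_staircaseRel P Q hP hQ b rfl hb
  · intro c hc
    obtain ⟨b, hb, h⟩ := ExactBicomplex.exists_linked (D := D.transpose) (n := n) c (by
      change c ≫ Q.complex.d n ((ComplexShape.up ℕ).next n) = 0 at hc
      rw [CochainComplex.next] at hc
      exact hc)
    refine ⟨b, ?_, h.transpose⟩
    change P.complex.d ((ComplexShape.down ℕ).prev n) n ≫ b = 0
    rw [ChainComplex.prev]
    exact hb
  · intro b c h
    change (∃ b₀ : P.complex.X ((ComplexShape.down ℕ).next n) ⟶ N,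
      P.complex.d n ((ComplexShape.down ℕ).next n) ≫ b₀ = b) ↔
      ∃ c₀ : M ⟶ Q.complex.X ((ComplexShape.up ℕ).prev n),
        c₀ ≫ Q.complex.d ((ComplexShape.up ℕ).prev n) n = c
    cases n with
    | zero =>
      -- In degree 0 the default neighbour is 0 itself with zero differential, so being a coboundary
      -- means being zero.
      rw [P.complex.shape _ _ (by simp), Q.complex.shape _ _ (by simp)]
      simp only [zero_comp, comp_zero, exists_const]
      exact ⟨fun hb => (ExactBicomplex.Linked.eq_zero (D := D) h hb.symm).symm, fun hc =>
        (ExactBicomplex.Linked.eq_zero (ExactBicomplex.Linked.transpose (D := D) h) hc.symm).symm⟩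
    | succ n =>
      rw [ChainComplex.next_nat_succ, CochainComplex.prev_nat_succ]
      exact ⟨ExactBicomplex.Linked.exists_eq (D := D) h,
        ExactBicomplex.Linked.exists_eq (ExactBicomplex.Linked.transpose (D := D) h)⟩

end RelativeBalance

/-! ### The natural isomorphism for modules of finite Gorenstein dimension -/

section Comparison

variable {A : Type u} [Ring A]

/-- The proper Gorenstein-projective resolution of a module of finite dimension. -/
noncomputable abbrev gpResolution (M : (FiniteGPDim A).FullSubcategory) :
    ProperResolution (GorensteinProjective A) M.obj :=
  properResolution _ ⟨M.obj, M.property.1⟩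

/-- The proper Gorenstein-injective coresolution of a module of finite dimension. -/
noncomputable abbrev giCoresolution (N : (FiniteGIDim A).FullSubcategory) :
    ProperCoresolution (GorensteinInjective A) N.obj :=
  properCoresolution _ ⟨N.obj, N.property.1⟩

variable (M : (FiniteGPDim A).FullSubcategory) (N : (FiniteGIDim A).FullSubcategory)

theorem exists_extGP_iso_extGI (n : ℕ) :
    ∃ e : (((homTo _).obj (op (gpResolution M).complex)).obj N.obj).homology n ≅
      (((homFrom _).obj (op M.obj)).obj (giCoresolution N).complex).homology n,
      InducedBy e (StaircaseRel (gpResolution M) (giCoresolution N) n) :=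
  exists_inducedBy_staircaseRel _ _
    (fun q => acyclic_homTo_properResolution M.property.2 ((giCoresolution N).mem q))
    (fun p => acyclic_homFrom_properCoresolution N.property.2 ((gpResolution M).mem p)) n

theorem exists_gpResolution_staircaseRel {n : ℕ} (b : (gpResolution M).complex.X n ⟶ N.obj)
    {k : ℕ} (hk : (ComplexShape.down ℕ).prev n = k)
    (hb : (gpResolution M).complex.d k n ≫ b = 0) :
    ∃ c : M.obj ⟶ (giCoresolution N).complex.X n,
      c ≫ (giCoresolution N).complex.d n ((ComplexShape.up ℕ).next n) = 0 ∧
      StaircaseRel (gpResolution M) (giCoresolution N) n b c :=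
  exists_staircaseRel _ _
    (fun q => acyclic_homTo_properResolution M.property.2 ((giCoresolution N).mem q))
    (fun p => acyclic_homFrom_properCoresolution N.property.2 ((gpResolution M).mem p)) b hk hb

/-- The balance isomorphism of relative extension groups. -/
noncomputable def extGPIsoExtGI (n : ℕ) :
    ((extGPFinite A n).obj (op M)).obj N ≅ ((extGIFinite A n).obj (op M)).obj N :=
  (exists_extGP_iso_extGI M N n).choose

theorem inducedBy_extGPIsoExtGI (n : ℕ) :
    InducedBy (extGPIsoExtGI M N n) (StaircaseRel (gpResolution M) (giCoresolution N) n) :=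
  (exists_extGP_iso_extGI M N n).choose_spec

variable {M N}

theorem extGPIsoExtGI_naturality_right {N' : (FiniteGIDim A).FullSubcategory} (g : N ⟶ N')
    (n : ℕ) :
    ((extGPFinite A n).obj (op M)).map g ≫ (extGPIsoExtGI M N' n).hom =
      (extGPIsoExtGI M N n).hom ≫ ((extGIFinite A n).obj (op M)).map g := by
  refine (inducedBy_extGPIsoExtGI M N n).naturality (inducedBy_extGPIsoExtGI M N' n)
    (fun b hb => exists_gpResolution_staircaseRel M N b rfl hb)
    (((homTo _).obj (op (gpResolution M).complex)).map g.hom)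
    (((homFrom _).obj (op M.obj)).map
      (ProperCoresolution.lift (giCoresolution N) (giCoresolution N') g.hom))
    fun (b : (gpResolution M).complex.X n ⟶ N.obj)
      (c : M.obj ⟶ (giCoresolution N).complex.X n) h => ?_
  have := h.map (P' := gpResolution M) (f := 𝟙 _) (𝟙 _) _ (by simp)
    (ProperCoresolution.η_lift (giCoresolution N) (giCoresolution N') g.hom)
  rw [HomologicalComplex.id_f, Category.id_comp, Category.id_comp] at this
  exact this

theorem extGPIsoExtGI_naturality_left {M' : (FiniteGPDim A).FullSubcategory} (f : M' ⟶ M)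
    (n : ℕ) :
    ((extGPFinite A n).map f.op).app N ≫ (extGPIsoExtGI M' N n).hom =
      (extGPIsoExtGI M N n).hom ≫ ((extGIFinite A n).map f.op).app N := by
  refine (inducedBy_extGPIsoExtGI M N n).naturality (inducedBy_extGPIsoExtGI M' N n)
    (fun b hb => exists_gpResolution_staircaseRel M N b rfl hb)
    (((homTo _).map (ProperResolution.lift (gpResolution M') (gpResolution M) f.hom).op).app N.obj)
    (((homFrom _).map f.hom.op).app (giCoresolution N).complex)
    fun (b : (gpResolution M).complex.X n ⟶ N.obj)
      (c : M.obj ⟶ (giCoresolution N).complex.X n) h => ?_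
  have := h.map (Q' := giCoresolution N) (g := 𝟙 _) _ (𝟙 _)
    (ProperResolution.lift_π (gpResolution M') (gpResolution M) f.hom) (by simp)
  rw [HomologicalComplex.id_f, Category.comp_id, Category.comp_id] at this
  exact this

end Comparison

end GorensteinHom

theorem mainTheorem9 (R : Type v) (A : Type u) [CommRing R] [IsArtinianRing R] [Ring A]
    [Algebra R A] [Module.Finite R A] (n : ℕ) :
    Nonempty (GorensteinHom.extGPFinite A n ≅ GorensteinHom.extGIFinite A n) := by
  refine ⟨NatIso.ofComponents (fun M => NatIso.ofComponents
    (fun N => GorensteinHom.extGPIsoExtGI M.unop N n)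
    fun g => GorensteinHom.extGPIsoExtGI_naturality_right g n) fun f => ?_⟩
  ext N : 2
  exact GorensteinHom.extGPIsoExtGI_naturality_left f.unop n
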